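/- A \emph{weight} is a continuous increasing (i.e. non-decreasing) function $\omega:[0,\infty)\to[0,\infty)$ with $\omega(t)\to\infty$, $\omega(2t)=O(\omega(t))$ and $\log t=o(\omega(t))$ as $t\to\infty$, and such that $t\mapsto\omega(e^t)$ is convex on $[0,\infty)$. It is \emph{normalized} if $\omega=0$ on $[0,1]$. Two weights are \emph{equivalent} if each is $O$ of the other at infinity. For a normalized weight $\omega$ put $\varphi^*(t)=\sup_{s\ge0}(st-\omega(e^s))$ for $t\ge 0$, and $\Omega^\rho_k=\frac1{k!}\exp(\frac1\rho\varphi^*(\rho k))$ for $\rho>0$, $k\in\mathbb N$. For a positive sequence $M$ let $M^\circ_0=1$ and $M^\circ_k=\max\{M_jM_{\alpha_1}\cdots M_{\alpha_j}: j\ge 1,\ \alpha_i\ge1,\ \alpha_1+\dots+\alpha_j=k\}$ for $k\ge1$; write $M\preceq N$ if there are $C,\rho>0$ with $M_k\le C\rho^kN_k$ for all $k$. For open $U\subseteq\mathbb R^n$, the Beurling class $\mathcal E^{(\omega)}(U,\mathbb R^m)$ (likewise with values in $\mathbb C$) consists of all smooth $f$ on $U$ such that for every compact $K\subseteq U$ and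 every $\rho>0$, $$\sup_{x\in K,\,k\in\mathbb N}\|f^{(k)}(x)\|\exp(-\tfrac1\rho\varphi^*(\rho k))<\infty ;$$ for open $V\subseteq\mathbb R^m$, $\mathcal E^{(\omega)}(U,V)$ is the set of those $f\in\mathcal E^{(\omega)}(U,\mathbb R^m)$ with $f(U)\subseteq V$. \textbf{Theorem 6.5.} Let $\omega$ be a normalized weight. Consider the following conditions. (1) $\mathcal E^{(\omega)}$ is stable under composition: $g\in\mathcal E^{(\omega)}(U,V)$ and $f\in\mathcal E^{(\omega)}(V,W)$ imply $f\circ g\in\mathcal E^{(\omega)}(U,W)$, for all $p,q,r\ge1$ and all open $U\subseteq\mathbb R^p$, $V\subseteq\mathbb R^q$, $W\subseteq\mathbb R^r$. (2) $\mathcal E^{(\omega)}$ is holomorphically closed: for all $n\ge1$ and all open $U\subseteq\mathbb R^n$, $f\circ g\in\mathcal E^{(\omega)}(U,\mathbb C)$ for every $g\in\mathcal E^{(\omega)}(U,\mathbb R)$ and every $f$ holomorphic in an open neighborhood of $g(U)$ in $\mathbb C$. (3) For each $\rho>0$ there is $\tau>0$ with $(\Omega^\tau)^\circ\preceq\Omega^\rho$.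 (4) There is $H\ge1$ such that $(\Omega^\rho)^\circ\preceq\Omega^{H\rho}$ for each $\rho>0$. (5) $\omega$ is equivalent to a sub-additive (not necessarily normalized) weight. (6) There are $C>0$ and $t_0>0$ such that $\omega(\lambda t)\le C\lambda\,\omega(t)$ for all $\lambda\ge1$ and $t\ge t_0$. If $\omega(t)=O(t)$ as $t\to\infty$, then (1), (3), (4), (5) and (6) are equivalent. If $\omega(t)=o(t)$ as $t\to\infty$, then all six conditions are equivalent. For every normalized weight $\omega$, with no further assumption, (2) $\Rightarrow$ (6) $\Leftrightarrow$ (5) $\Rightarrow$ (4) $\Rightarrow$ (3) $\Rightarrow$ (1). -/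

import Mathlib

open Set Filter Asymptotics

noncomputable section

/-- Continuous increasing functions `[0, ∞) → [0, ∞)` tending to infinity with
`ω(2t) = O(ω(t))`, `log t = o(ω(t))` and `t ↦ ω(e^t)` convex on `[0, ∞)`.
The normalization `ω = 0` on `[0, 1]` is not part of this predicate.
Only the restriction of `ω` to `[0, ∞)` is relevant. -/
structure IsPreWeightFunction (ω : ℝ → ℝ) : Prop where
  nonneg : ∀ t, 0 ≤ t → 0 ≤ ω t
  continuousOn : ContinuousOn ω (Ici 0)
  monotoneOn : MonotoneOn ω (Ici 0)
  tendsto_atTop : Tendsto ω atTop atTop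
  doubling : (fun t => ω (2 * t)) =O[atTop] ω
  log_isLittleO : Real.log =o[atTop] ω
  convexOn_exp : ConvexOn ℝ (Ici 0) (fun t => ω (Real.exp t))

/-- Weight functions: normalized by `ω = 0` on `[0, 1]`. -/
structure IsWeightFunction (ω : ℝ → ℝ) : Prop extends IsPreWeightFunction ω where
  zero_on_unit : ∀ t ∈ Icc (0 : ℝ) 1, ω t = 0

/-- `ω(t) = O(t)`. -/
def WeightBigO (ω : ℝ → ℝ) : Prop := ω =O[atTop] (fun t => t)

/-- `ω(t) = o(t)`. -/
def WeightLittleO (ω : ℝ → ℝ) : Prop := ω =o[atTop] (fun t => t)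

/-- `∃ C > 0 ∃ t₀ > 0 ∀ λ ≥ 1 ∀ t ≥ t₀ : ω(λ t) ≤ C λ ω(t)`. -/
def WeightSubhomogeneous (ω : ℝ → ℝ) : Prop :=
  ∃ C > 0, ∃ t₀ > 0, ∀ l : ℝ, 1 ≤ l → ∀ t : ℝ, t₀ ≤ t → ω (l * t) ≤ C * l * ω t

/-- Equivalence of weights: each is `O` of the other at infinity. -/
def WeightEquiv (ω σ : ℝ → ℝ) : Prop := σ =O[atTop] ω ∧ ω =O[atTop] σ

/-- Sub-additivity on `[0, ∞)`. -/
def WeightSubadditive (ω : ℝ → ℝ) : Prop :=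
  ∀ s t : ℝ, 0 ≤ s → 0 ≤ t → ω (s + t) ≤ ω s + ω t

/-- Equivalence to a sub-additive weight. A nonzero sub-additive increasing function cannot vanish
on `[0, 1]`, so the sub-additive weight is not required to be normalized. -/
def EquivSubadditiveWeight (ω : ℝ → ℝ) : Prop :=
  ∃ σ : ℝ → ℝ, IsPreWeightFunction σ ∧ WeightSubadditive σ ∧ WeightEquiv ω σ

/-- The Young conjugate `φ*(t) = sup {s t - φ(s) : s ≥ 0}` of `φ(s) = ω(e^s)`. -/
def youngConj (ω : ℝ → ℝ) (t : ℝ) : ℝ :=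
  sSup ((fun s => s * t - ω (Real.exp s)) '' Ici 0)

/-- The associated sequences `Ω^ρ_k = (1 / k!) exp ((1 / ρ) φ*(ρ k))`. -/
def assocSeq (ω : ℝ → ℝ) (ρ : ℝ) (k : ℕ) : ℝ :=
  1 / (k.factorial : ℝ) * Real.exp (1 / ρ * youngConj ω (ρ * k))

/-- `M°_k = max {M_j M_{α₁} ⋯ M_{α_j} : α_i ≥ 1, α₁ + ⋯ + α_j = k}` for `k ≥ 1`, and `M°_0 = 1`.
The maximum is over the (finitely many) compositions of `k`. -/
def seqCirc (M : ℕ → ℝ) : ℕ → ℝ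
  | 0 => 1
  | k + 1 => ⨆ c : Composition (k + 1), M c.length * ∏ i, M (c.blocksFun i)

/-- `M ≼ N` : `∃ C, ρ > 0 ∀ k : M_k ≤ C ρ^k N_k`. -/
def SeqPreceq (M N : ℕ → ℝ) : Prop :=
  ∃ C > 0, ∃ ρ > 0, ∀ k : ℕ, M k ≤ C * ρ ^ k * N k

/-- For each `ρ > 0` there is `τ > 0` with `(Ω^τ)° ≼ Ω^ρ`. -/
def BeurlingFdB (ω : ℝ → ℝ) : Prop :=
  ∀ ρ > 0, ∃ τ > 0, SeqPreceq (seqCirc (assocSeq ω τ)) (assocSeq ω ρ)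

/-- There is `H ≥ 1` such that `(Ω^ρ)° ≼ Ω^{Hρ}` for each `ρ > 0`. -/
def UniformFdB (ω : ℝ → ℝ) : Prop :=
  ∃ H : ℝ, 1 ≤ H ∧ ∀ ρ > 0, SeqPreceq (seqCirc (assocSeq ω ρ)) (assocSeq ω (H * ρ))

/-- Membership in the Beurling class `E^(ω)(U, F)` for open `U`: `f` is smooth on `U` and for each
compact `K ⊆ U` and each `ρ > 0` the numbers `‖f^(k)(x)‖ exp (-(1 / ρ) φ*(ρ k))`, for `x ∈ K` and
`k ∈ ℕ`, are bounded. -/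
def MemBeurling {E F : Type*} [NormedAddCommGroup E] [NormedSpace ℝ E]
    [NormedAddCommGroup F] [NormedSpace ℝ F] (ω : ℝ → ℝ) (U : Set E) (f : E → F) : Prop :=
  ContDiffOn ℝ (⊤ : ℕ∞) f U ∧
    ∀ K ⊆ U, IsCompact K → ∀ ρ > 0, ∃ C : ℝ, ∀ x ∈ K, ∀ k : ℕ,
      ‖iteratedFDeriv ℝ k f x‖ * Real.exp (-(1 / ρ * youngConj ω (ρ * k))) ≤ C

/-- `E^(ω)` is stable under composition. -/
def BeurlingStableComp (ω : ℝ → ℝ) : Prop :=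
  ∀ p q r : ℕ, 0 < p → 0 < q → 0 < r →
    ∀ (U : Set (EuclideanSpace ℝ (Fin p))) (V : Set (EuclideanSpace ℝ (Fin q)))
      (W : Set (EuclideanSpace ℝ (Fin r))), IsOpen U → IsOpen V → IsOpen W →
    ∀ (g : EuclideanSpace ℝ (Fin p) → EuclideanSpace ℝ (Fin q))
      (f : EuclideanSpace ℝ (Fin q) → EuclideanSpace ℝ (Fin r)),
      MapsTo g U V → MapsTo f V W → MemBeurling ω U g → MemBeurling ω V f →
      MemBeurling ω U (f ∘ g)

/-- `E^(ω)` is holomorphically closed: `f ∘ g ∈ E^(ω)(U, ℂ)` whenever `g ∈ E^(ω)(U, ℝ)` and `f` is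
holomorphic in an open neighborhood `O ⊆ ℂ` of `g(U)`. -/
def BeurlingHolClosed (ω : ℝ → ℝ) : Prop :=
  ∀ n : ℕ, 0 < n → ∀ U : Set (EuclideanSpace ℝ (Fin n)), IsOpen U →
    ∀ g : EuclideanSpace ℝ (Fin n) → ℝ, MemBeurling ω U g →
    ∀ (O : Set ℂ) (f : ℂ → ℂ), IsOpen O → (∀ x ∈ U, (g x : ℂ) ∈ O) → DifferentiableOn ℂ f O →
      MemBeurling ω U (fun x => f (g x : ℂ))

end

/-! Everything rests on reading `weightSeq ω ρ k`, which is `k!` times `Ω^ρ_k`, as the supremum of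
`t ^ k * exp (-ω(t) / ρ)` over `t ≥ 1`.

Sub-homogeneity yields `ω(∑ xᵢ) ≤ C ∑ (ω(xᵢ) + 1)`. Combined with the multinomial theorem, this
bounds a product of terms of `Ω^ρ` by a single term of the total order with parameter `Hρ`
(`exists_prod_weightSeq_le`). A product `M_j M_{α₁} ⋯ M_{α_j}` has order exceeding `k` by exactly
`j`; lowering each `αᵢ` by one removes the excess and gives the uniform Faà di Bruno condition.
Sub-homogeneity amounts to sub-additivity up to equivalence through the envelope `sup_{l ≥ 1} ω(l t)
/ l`. Faà di Bruno's formula turns the condition on sequences into stability under composition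
(`MemBeurling.comp`). If `ω(t) = o(t)`, Cauchy estimates place holomorphic functions in the class,
so holomorphic closedness follows as well.

The way back is `weightSubhomogeneous_of_entire`. If sub-homogeneity fails, there are `n_j`, `t_j`
with `ω(n_j t_j) ≥ 8 (j + 1) n_j ω(t_j)`. The series `g = ∑ ε_j cos(t_j x)` with `ε_j = exp(-(j + 1)
ω(t_j))` lies in the class and `F(z) = ∑ (z / (j + 1))^{n_j}` is entire, but `F ∘ g` contains the
frequency `n_j t_j` with too large a coefficient. Nothing cancels, because only nonnegative
combinations of cosines occur; `cosSemiring` encodes this. Holomorphic closedness lets `F` operate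
directly; composition stability does so once entire functions belong to the class, for which `ω(t) =
O(t)` suffices. -/

noncomputable section

/-- The weight sequence `exp ((1 / ρ) φ*(ρ k))`, so that `Ω^ρ_k = weightSeq ω ρ k / k!`. -/
def weightSeq (ω : ℝ → ℝ) (ρ : ℝ) (k : ℕ) : ℝ :=
  Real.exp (1 / ρ * youngConj ω (ρ * k))

end

/-! ### Weight sequences as suprema, and their dependence on the parameter -/

theorem weightSeq_pos (ω : ℝ → ℝ) (ρ : ℝ) (k : ℕ) : 0 < weightSeq ω ρ k := Real.exp_pos _

theorem assocSeq_eq_weightSeq_div (ω : ℝ → ℝ) (ρ : ℝ) (k : ℕ) :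
    assocSeq ω ρ k = weightSeq ω ρ k / k.factorial := by
  simp only [assocSeq, weightSeq]; ring

theorem assocSeq_pos (ω : ℝ → ℝ) (ρ : ℝ) (k : ℕ) : 0 < assocSeq ω ρ k := by
  rw [assocSeq_eq_weightSeq_div]
  exact div_pos (weightSeq_pos ..) (by positivity)

namespace IsPreWeightFunction

variable {ω : ℝ → ℝ}

theorem exists_log_le (hω : IsPreWeightFunction ω) {δ : ℝ} (hδ : 0 < δ) :
    ∃ B, 0 ≤ B ∧ ∀ t, 1 ≤ t → Real.log t ≤ δ * ω t + B := by
  have h := hω.log_isLittleO.bound hδ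
  obtain ⟨T, hT⟩ := eventually_atTop.1 h
  refine ⟨Real.log (max T 1), Real.log_nonneg (le_max_right _ _), fun t ht => ?_⟩
  have hn := hω.nonneg t (by linarith)
  rcases le_total T t with h1 | h1
  · have := hT t h1
    rw [Real.norm_eq_abs, Real.norm_eq_abs, abs_of_nonneg hn] at this
    have h2 := le_abs_self (Real.log t)
    have h3 := Real.log_nonneg (le_max_right T 1)
    linarith
  · have : Real.log t ≤ Real.log (max T 1) :=
      Real.log_le_log (by linarith) (h1.trans (le_max_left _ _))
    have := mul_nonneg hδ.le hn
    linarith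

theorem exists_le_of_isBigO (hω : IsPreWeightFunction ω) {σ : ℝ → ℝ}
    (hσ : ∀ t, 0 ≤ t → 0 ≤ σ t) (h : ω =O[atTop] σ) :
    ∃ D, 1 ≤ D ∧ ∀ t, 0 ≤ t → ω t ≤ D * (σ t + 1) := by
  obtain ⟨C, hC⟩ := h.bound
  obtain ⟨T, hT⟩ := eventually_atTop.1 hC
  have hm := hω.nonneg (max T 0) (le_max_right _ _)
  refine ⟨1 + |C| + ω (max T 0), by linarith [abs_nonneg C], fun t ht => ?_⟩
  have hs := hσ t ht
  rcases le_total T t with h1 | h1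
  · have := hT t h1
    rw [Real.norm_eq_abs, Real.norm_eq_abs, abs_of_nonneg hs] at this
    have h2 := le_abs_self (ω t)
    have h3 : C * σ t ≤ |C| * σ t := mul_le_mul_of_nonneg_right (le_abs_self C) hs
    nlinarith [abs_nonneg C, mul_nonneg hm hs]
  · have : ω t ≤ ω (max T 0) :=
      hω.monotoneOn ht (mem_Ici.2 (le_max_right _ _)) (h1.trans (le_max_left _ _))
    nlinarith [abs_nonneg C, mul_nonneg hm hs, mul_nonneg (abs_nonneg C) hs]

theorem exists_doubling (hω : IsPreWeightFunction ω) :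
    ∃ D, 1 ≤ D ∧ ∀ t, 0 ≤ t → ω (2 * t) ≤ D * (ω t + 1) := by
  obtain ⟨C, hC⟩ := hω.doubling.bound
  obtain ⟨T, hT⟩ := eventually_atTop.1 hC
  have hm := hω.nonneg (2 * max T 0) (by positivity)
  refine ⟨1 + |C| + ω (2 * max T 0), by linarith [abs_nonneg C], fun t ht => ?_⟩
  have hs := hω.nonneg t ht
  rcases le_total T t with h1 | h1
  · have := hT t h1
    rw [Real.norm_eq_abs, Real.norm_eq_abs, abs_of_nonneg hs] at this
    have h2 := le_abs_self (ω (2 * t))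
    have h3 : C * ω t ≤ |C| * ω t := mul_le_mul_of_nonneg_right (le_abs_self C) hs
    nlinarith [abs_nonneg C, mul_nonneg hm hs]
  · have : ω (2 * t) ≤ ω (2 * max T 0) :=
      hω.monotoneOn (mem_Ici.2 (by positivity)) (mem_Ici.2 (by positivity))
        (by linarith [h1.trans (le_max_left T 0)])
    nlinarith [abs_nonneg C, mul_nonneg hm hs, mul_nonneg (abs_nonneg C) hs]

theorem bddAbove_youngConj (hω : IsPreWeightFunction ω) (x : ℝ) :
    BddAbove ((fun s => s * x - ω (Real.exp s)) '' Ici 0) := by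
  have hx : 0 < |x| + 1 := by positivity
  obtain ⟨B, hB, h⟩ := hω.exists_log_le (δ := 1 / (|x| + 1)) (by positivity)
  refine ⟨(|x| + 1) * B, ?_⟩
  rintro _ ⟨s, hs, rfl⟩
  have h1 := h (Real.exp s) (Real.one_le_exp hs)
  rw [Real.log_exp] at h1
  have h2 : (|x| + 1) * s ≤ ω (Real.exp s) + (|x| + 1) * B := by
    calc (|x| + 1) * s ≤ (|x| + 1) * (1 / (|x| + 1) * ω (Real.exp s) + B) := by gcongr
      _ = _ := by field_simp
  have h3 : s * x ≤ s * |x| := mul_le_mul_of_nonneg_left (le_abs_self x) hs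
  have : 0 ≤ s := hs
  dsimp only
  linarith

theorem le_youngConj (hω : IsPreWeightFunction ω) {s : ℝ} (hs : 0 ≤ s) (x : ℝ) :
    s * x - ω (Real.exp s) ≤ youngConj ω x :=
  le_csSup (hω.bddAbove_youngConj x) ⟨s, hs, rfl⟩

/-- The substitution `t = e^s` in the Young conjugate. Together with `weightSeq_le` it characterizes
the sequence as a supremum over `t ≥ 1`, which replaces the conjugate in most later estimates. -/
theorem pow_mul_exp_le_weightSeq (hω : IsPreWeightFunction ω) {ρ : ℝ} (hρ : 0 < ρ) {t : ℝ}
    (ht : 1 ≤ t) (k : ℕ) : t ^ k * Real.exp (-(ω t / ρ)) ≤ weightSeq ω ρ k := by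
  have h := hω.le_youngConj (Real.log_nonneg ht) (ρ * k)
  rw [Real.exp_log (by linarith)] at h
  have : t ^ k = Real.exp (Real.log t * k) := by
    rw [mul_comm, Real.exp_nat_mul, Real.exp_log (by linarith)]
  rw [this, ← Real.exp_add, weightSeq]
  apply Real.exp_le_exp.2
  calc Real.log t * k + -(ω t / ρ) = 1 / ρ * (Real.log t * (ρ * k) - ω t) := by field_simp; ring
    _ ≤ _ := by gcongr

end IsPreWeightFunction

theorem youngConj_le {ω : ℝ → ℝ} {x B : ℝ} (h : ∀ s, 0 ≤ s → s * x - ω (Real.exp s) ≤ B) :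
    youngConj ω x ≤ B := by
  refine csSup_le ⟨_, 0, by simp, rfl⟩ ?_
  rintro _ ⟨s, hs, rfl⟩
  exact h s hs

theorem weightSeq_le {ω : ℝ → ℝ} {ρ : ℝ} (hρ : 0 < ρ) {k : ℕ} {B : ℝ}
    (h : ∀ t, 1 ≤ t → t ^ k * Real.exp (-(ω t / ρ)) ≤ B) : weightSeq ω ρ k ≤ B := by
  have hB : 0 < B := lt_of_lt_of_le (by positivity) (h 1 le_rfl)
  rw [weightSeq, ← Real.le_log_iff_exp_le hB]
  have : youngConj ω (ρ * k) ≤ ρ * Real.log B := by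
    apply youngConj_le
    intro s hs
    have h1 := h (Real.exp s) (Real.one_le_exp hs)
    rw [← Real.exp_nat_mul, ← Real.exp_add, ← Real.le_log_iff_exp_le hB] at h1
    calc s * (ρ * k) - ω (Real.exp s) = ρ * (k * s + -(ω (Real.exp s) / ρ)) := by field_simp; ring
      _ ≤ _ := by gcongr
  calc 1 / ρ * youngConj ω (ρ * k) ≤ 1 / ρ * (ρ * Real.log B) := by gcongr
    _ = _ := by field_simp

/-- The factor 2 spares a proof that the supremum is attained. -/
theorem exists_weightSeq_le_two_mul {ω : ℝ → ℝ} {ρ : ℝ} (hρ : 0 < ρ) (k : ℕ) :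
    ∃ t, 1 ≤ t ∧ weightSeq ω ρ k ≤ 2 * (t ^ k * Real.exp (-(ω t / ρ))) := by
  by_contra! h
  have : weightSeq ω ρ k ≤ weightSeq ω ρ k / 2 :=
    weightSeq_le hρ fun t ht => by linarith [h t ht]
  linarith [weightSeq_pos ω ρ k]

namespace IsPreWeightFunction

variable {ω : ℝ → ℝ}

theorem weightSeq_mono (hω : IsPreWeightFunction ω) {ρ τ : ℝ} (hρ : 0 < ρ) (h : ρ ≤ τ) (k : ℕ) :
    weightSeq ω ρ k ≤ weightSeq ω τ k := by
  refine weightSeq_le hρ fun t ht => ?_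
  have := hω.nonneg t (by linarith)
  refine le_trans ?_ (hω.pow_mul_exp_le_weightSeq (hρ.trans_le h) ht k)
  gcongr

/-- Derivation closedness. -/
theorem exists_weightSeq_succ_le (hω : IsPreWeightFunction ω) {ρ : ℝ} (hρ : 0 < ρ) :
    ∃ C, 1 ≤ C ∧ ∀ k, weightSeq ω ρ (k + 1) ≤ C * weightSeq ω (2 * ρ) k := by
  -- The extra factor `t` costs `exp (ω(t) / (2ρ))`, half of the available decay; the other half is
  -- the decay for parameter `2ρ`.
  obtain ⟨B, hB, h⟩ := hω.exists_log_le (δ := 1 / (2 * ρ)) (by positivity)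
  refine ⟨Real.exp B, Real.one_le_exp hB, fun k => weightSeq_le hρ fun t ht => ?_⟩
  have h1 : t ≤ Real.exp (1 / (2 * ρ) * ω t + B) := by
    rw [← Real.log_le_iff_le_exp (by linarith)]; exact h t ht
  have h2 := hω.pow_mul_exp_le_weightSeq (ρ := 2 * ρ) (by positivity) ht k
  calc t ^ (k + 1) * Real.exp (-(ω t / ρ))
      ≤ t ^ k * Real.exp (1 / (2 * ρ) * ω t + B) * Real.exp (-(ω t / ρ)) := by
        rw [pow_succ]; gcongr
    _ = Real.exp B * (t ^ k * Real.exp (-(ω t / (2 * ρ)))) := by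
        have : -(ω t / (2 * ρ)) = 1 / (2 * ρ) * ω t + -(ω t / ρ) := by field_simp; ring
        rw [this, Real.exp_add, Real.exp_add]; ring
    _ ≤ _ := by gcongr

/-- Geometric factors are absorbed by decreasing the parameter. -/
theorem exists_pow_mul_weightSeq_le (hω : IsPreWeightFunction ω) (A : ℝ) {τ : ℝ} (hτ : 0 < τ) :
    ∃ ρ > 0, ∃ C, 1 ≤ C ∧ ∀ k, A ^ k * weightSeq ω ρ k ≤ C * weightSeq ω τ k := by
  obtain ⟨D, hD, hdbl⟩ := hω.exists_doubling
  have hD0 : 0 < D := by linarith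
  have key : ∀ n : ℕ, ∃ ρ > 0, ∃ C, 1 ≤ C ∧
      ∀ k, (2 ^ n : ℝ) ^ k * weightSeq ω ρ k ≤ C * weightSeq ω τ k := by
    intro n
    induction n with
    | zero => exact ⟨τ, hτ, 1, le_rfl, fun k => by simp⟩
    | succ n ih =>
      obtain ⟨ρ, hρ, C, hC, h⟩ := ih
      -- Each factor `2 ^ k` replaces `t` by `2t`, and `ω(2t) ≤ D (ω(t) + 1)` pays for it by
      -- dividing the parameter by `D`.
      refine ⟨ρ / D, by positivity, C * Real.exp (D / ρ),
        one_le_mul_of_one_le_of_one_le hC (Real.one_le_exp (by positivity)), fun k => ?_⟩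
      have h2 : (2 : ℝ) ^ k * weightSeq ω (ρ / D) k ≤ Real.exp (D / ρ) * weightSeq ω ρ k := by
        rw [← le_div_iff₀' (by positivity)]
        refine weightSeq_le (by positivity) fun t ht => ?_
        rw [le_div_iff₀' (by positivity)]
        have h3 := hω.pow_mul_exp_le_weightSeq hρ (t := 2 * t) (by linarith) k
        have h4 : -(ω t / (ρ / D)) ≤ D / ρ + -(ω (2 * t) / ρ) := by
          have : D / ρ + -(ω (2 * t) / ρ) - -(ω t / (ρ / D)) = (D * (ω t + 1) - ω (2 * t)) / ρ := by
            field_simp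
            ring
          rw [← sub_nonneg, this]
          exact div_nonneg (by linarith [hdbl t (by linarith)]) hρ.le
        calc (2 : ℝ) ^ k * (t ^ k * Real.exp (-(ω t / (ρ / D))))
            ≤ (2 : ℝ) ^ k * (t ^ k * Real.exp (D / ρ + -(ω (2 * t) / ρ))) := by gcongr
          _ = Real.exp (D / ρ) * ((2 * t) ^ k * Real.exp (-(ω (2 * t) / ρ))) := by
            rw [Real.exp_add, mul_pow]; ring
          _ ≤ _ := by gcongr
      calc (2 ^ (n + 1) : ℝ) ^ k * weightSeq ω (ρ / D) k
          = (2 ^ n : ℝ) ^ k * ((2 : ℝ) ^ k * weightSeq ω (ρ / D) k) := by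
            rw [pow_succ, mul_pow]; ring
        _ ≤ (2 ^ n : ℝ) ^ k * (Real.exp (D / ρ) * weightSeq ω ρ k) := by gcongr
        _ = Real.exp (D / ρ) * ((2 ^ n : ℝ) ^ k * weightSeq ω ρ k) := by ring
        _ ≤ Real.exp (D / ρ) * (C * weightSeq ω τ k) := by gcongr _ * ?_; exact h k
        _ = _ := by ring
  obtain ⟨n, hn⟩ := pow_unbounded_of_one_lt |A| (one_lt_two : (1 : ℝ) < 2)
  obtain ⟨ρ, hρ, C, hC, h⟩ := key n
  refine ⟨ρ, hρ, C, hC, fun k => le_trans ?_ (h k)⟩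
  have := weightSeq_pos ω ρ k
  gcongr ?_ * _
  calc A ^ k ≤ |A ^ k| := le_abs_self _
    _ = |A| ^ k := abs_pow ..
    _ ≤ _ := by gcongr

end IsPreWeightFunction

namespace IsWeightFunction

variable {ω : ℝ → ℝ}

theorem one_le_weightSeq (hω : IsWeightFunction ω) {ρ : ℝ} (hρ : 0 < ρ) (k : ℕ) :
    1 ≤ weightSeq ω ρ k := by
  have := hω.pow_mul_exp_le_weightSeq hρ (t := 1) le_rfl k
  simpa [hω.zero_on_unit 1 (by simp)] using this

theorem weightSeq_zero (hω : IsWeightFunction ω) {ρ : ℝ} (hρ : 0 < ρ) :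
    weightSeq ω ρ 0 = 1 := by
  refine le_antisymm (weightSeq_le hρ fun t ht => ?_) (hω.one_le_weightSeq hρ 0)
  have := hω.nonneg t (by linarith)
  simp
  positivity

end IsWeightFunction

theorem UniformFdB.beurlingFdB {ω : ℝ → ℝ} (h : UniformFdB ω) : BeurlingFdB ω := by
  obtain ⟨H, hH, h⟩ := h
  intro ρ hρ
  have hH0 : 0 < H := by linarith
  refine ⟨ρ / H, by positivity, ?_⟩
  have := h (ρ / H) (by positivity)
  rwa [mul_div_cancel₀ _ hH0.ne'] at this

/-! ### Sub-additivity, sub-homogeneity and finite sums -/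

theorem weightSubadditive_nat_mul_le {σ : ℝ → ℝ} (h : WeightSubadditive σ) {t : ℝ} (ht : 0 ≤ t)
    (n : ℕ) : σ ((n + 1 : ℕ) * t) ≤ (n + 1 : ℕ) * σ t := by
  induction n with
  | zero => simp
  | succ n ih =>
    have h1 := h ((n + 1 : ℕ) * t) t (by positivity) ht
    push_cast at ih h1 ⊢
    have h2 : ((n : ℝ) + 1 + 1) * t = (n + 1) * t + t := by ring
    rw [h2]
    linarith

theorem weightSubadditive_mul_le {σ : ℝ → ℝ} (hσ : IsPreWeightFunction σ)
    (h : WeightSubadditive σ) {l t : ℝ} (hl : 1 ≤ l) (ht : 0 ≤ t) : σ (l * t) ≤ 2 * l * σ t := by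
  obtain ⟨n, hn⟩ : ∃ n, ⌈l⌉₊ = n + 1 :=
    Nat.exists_eq_succ_of_ne_zero (Nat.ceil_pos.2 (by linarith)).ne'
  have h1 : l ≤ (n + 1 : ℕ) := hn ▸ Nat.le_ceil l
  have h2 : ((n + 1 : ℕ) : ℝ) < l + 1 := hn ▸ Nat.ceil_lt_add_one (by linarith)
  have h3 := hσ.nonneg t ht
  calc σ (l * t) ≤ σ ((n + 1 : ℕ) * t) :=
        hσ.monotoneOn (mem_Ici.2 (by positivity)) (mem_Ici.2 (by positivity)) (by gcongr)
    _ ≤ (n + 1 : ℕ) * σ t := weightSubadditive_nat_mul_le h ht n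
    _ ≤ _ := by gcongr; linarith

namespace IsPreWeightFunction

variable {ω : ℝ → ℝ}

theorem weightSubhomogeneous_of_equiv (hω : IsPreWeightFunction ω)
    (h : EquivSubadditiveWeight ω) : WeightSubhomogeneous ω := by
  obtain ⟨σ, hσ, hs, h1, h2⟩ := h
  obtain ⟨D, hD, hωσ⟩ := hω.exists_le_of_isBigO hσ.nonneg h2
  obtain ⟨E, hE, hσω⟩ := hσ.exists_le_of_isBigO hω.nonneg h1
  obtain ⟨T, hT⟩ := eventually_atTop.1 (hω.tendsto_atTop.eventually_ge_atTop 1)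
  refine ⟨D * (4 * E + 1), by positivity, max T 1, by positivity, fun l hl t ht => ?_⟩
  have ht0 : 0 ≤ t := by linarith [le_max_right T 1]
  have ht1 := hT t (by linarith [le_max_left T 1])
  calc ω (l * t) ≤ D * (σ (l * t) + 1) := hωσ _ (by positivity)
    _ ≤ D * (2 * l * (E * (ω t + 1)) + 1) := by
        gcongr
        refine (weightSubadditive_mul_le hσ hs hl ht0).trans ?_
        gcongr
        exact hσω t ht0
    _ ≤ D * (2 * l * (E * (ω t + ω t)) + l * ω t) := by
        gcongr
        exact one_le_mul_of_one_le_of_one_le hl ht1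
    _ = _ := by ring

theorem exists_mul_le_of_weightSubhomogeneous (hω : IsPreWeightFunction ω)
    (h : WeightSubhomogeneous ω) :
    ∃ C, 1 ≤ C ∧ ∀ l, 1 ≤ l → ∀ t, 0 ≤ t → ω (l * t) ≤ C * l * (ω t + 1) := by
  obtain ⟨C, hC, t₀, ht₀, h⟩ := h
  have hm := hω.nonneg t₀ ht₀.le
  refine ⟨1 + C + C * ω t₀, by nlinarith [mul_nonneg hC.le hm], fun l hl t ht => ?_⟩
  have hs := hω.nonneg t ht
  have hl0 : 0 < l := by linarith
  rcases le_total t₀ t with h1 | h1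
  · calc ω (l * t) ≤ C * l * ω t := h l hl t h1
      _ ≤ (1 + C + C * ω t₀) * l * (ω t + 1) := by
        gcongr
        · nlinarith [mul_nonneg hC.le hm]
        · linarith
  · calc ω (l * t) ≤ ω (l * t₀) :=
          hω.monotoneOn (mem_Ici.2 (by positivity)) (mem_Ici.2 (by positivity)) (by gcongr)
      _ ≤ C * l * ω t₀ := h l hl t₀ le_rfl
      _ = C * ω t₀ * l * 1 := by ring
      _ ≤ (1 + C + C * ω t₀) * l * (ω t + 1) := by
        gcongr
        · nlinarith [mul_nonneg hC.le hm]
        · linarith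

/-- Quasi-subadditivity for finite families. -/
theorem exists_sum_le_of_weightSubhomogeneous (hω : IsPreWeightFunction ω)
    (h : WeightSubhomogeneous ω) :
    ∃ C, 1 ≤ C ∧ ∀ (ι : Type) (s : Finset ι) (x : ι → ℝ), s.Nonempty → (∀ i ∈ s, 0 < x i) →
      ω (∑ i ∈ s, x i) ≤ C * ∑ i ∈ s, (ω (x i) + 1) := by
  obtain ⟨C, hC, h⟩ := hω.exists_mul_le_of_weightSubhomogeneous h
  refine ⟨C, hC, fun ι s x hs hx => ?_⟩
  set X := ∑ i ∈ s, x i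
  have hX : 0 < X := Finset.sum_pos hx hs
  -- Sub-homogeneity is applied to `x i` with the multiplier `X / x i`. Summing over `i` leaves `X`
  -- as a common factor on both sides, so the constant does not depend on the number of terms.
  have h1 : ∀ i ∈ s, x i * ω X ≤ X * (C * (ω (x i) + 1)) := by
    intro i hi
    have hxi := hx i hi
    have hle : x i ≤ X := Finset.single_le_sum (fun j hj => (hx j hj).le) hi
    have := h (X / x i) ((one_le_div hxi).2 hle) (x i) hxi.le
    rw [div_mul_cancel₀ _ hxi.ne'] at this
    calc x i * ω X ≤ x i * (C * (X / x i) * (ω (x i) + 1)) := by gcongr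
      _ = _ := by field_simp
  have h2 := Finset.sum_le_sum h1
  rw [← Finset.sum_mul, ← Finset.mul_sum, ← Finset.mul_sum] at h2
  exact le_of_mul_le_mul_left h2 hX

end IsPreWeightFunction

/-! ### Products of weight sequences and the uniform Faà di Bruno condition -/

theorem pow_div_factorial_mul_le {x y : ℝ} (hx : 0 ≤ x) (hy : 0 ≤ y) (a b : ℕ) :
    x ^ a / a.factorial * (y ^ b / b.factorial) ≤ (x + y) ^ (a + b) / (a + b).factorial := by
  have h1 : x ^ a * y ^ b * (a + b).choose a ≤ (x + y) ^ (a + b) := by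
    rw [add_pow]
    have := Finset.single_le_sum (f := fun m => x ^ m * y ^ (a + b - m) * ((a + b).choose m : ℝ))
      (s := Finset.range (a + b + 1)) (fun i _ => by positivity)
      (Finset.mem_range.2 (by omega : a < a + b + 1))
    simpa using this
  have h2 : ((a + b).choose a : ℝ) * a.factorial * b.factorial = (a + b).factorial := by
    rw [Nat.choose_symm_add]
    exact_mod_cast Nat.add_choose_mul_factorial_mul_factorial a b
  rw [div_mul_div_comm, div_le_div_iff₀ (by positivity) (by positivity), ← h2]
  calc x ^ a * y ^ b * (((a + b).choose a : ℝ) * a.factorial * b.factorial)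
      = x ^ a * y ^ b * (a + b).choose a * (a.factorial * b.factorial) := by ring
    _ ≤ _ := by gcongr

theorem prod_pow_div_factorial_le {ι : Type*} (s : Finset ι) {x : ι → ℝ} (hx : ∀ i ∈ s, 0 ≤ x i)
    (a : ι → ℕ) : ∏ i ∈ s, (x i ^ a i / (a i).factorial) ≤
      (∑ i ∈ s, x i) ^ (∑ i ∈ s, a i) / (∑ i ∈ s, a i).factorial := by
  classical
  induction s using Finset.induction_on with
  | empty => simp
  | insert i s hi ih =>
    rw [Finset.prod_insert hi, Finset.sum_insert hi, Finset.sum_insert hi]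
    have h0 : 0 ≤ x i := hx i (Finset.mem_insert_self _ _)
    have hs : ∀ j ∈ s, 0 ≤ x j := fun j hj => hx j (Finset.mem_insert_of_mem hj)
    refine le_trans ?_ (pow_div_factorial_mul_le h0 (Finset.sum_nonneg hs) _ _)
    gcongr
    exact ih hs

namespace IsPreWeightFunction

variable {ω : ℝ → ℝ}

/-- Near-maximizers `t i` are chosen for each factor, and their sum is used as a test point in the
supremum for parameter `Hρ`: powers combine by the multinomial bound, exponentials by
quasi-subadditivity. That `H` is chosen before `ρ` is what makes the resulting condition uniform. -/
theorem exists_prod_weightSeq_le (hω : IsPreWeightFunction ω) (h : WeightSubhomogeneous ω) :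
    ∃ H, 1 ≤ H ∧ ∀ ρ, 0 < ρ → ∃ A, 1 ≤ A ∧ ∀ (ι : Type) (s : Finset ι) (a : ι → ℕ), s.Nonempty →
      ∏ i ∈ s, (weightSeq ω ρ (a i) / (a i).factorial) ≤
        A ^ s.card * (weightSeq ω (H * ρ) (∑ i ∈ s, a i) / (∑ i ∈ s, a i).factorial) := by
  obtain ⟨C, hC, h⟩ := hω.exists_sum_le_of_weightSubhomogeneous h
  have hC0 : 0 < C := by linarith
  refine ⟨C, hC, fun ρ hρ => ⟨2 * Real.exp (1 / ρ), ?_, fun ι s a hs => ?_⟩⟩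
  · have := Real.one_le_exp (x := 1 / ρ) (by positivity)
    linarith
  choose t ht1 ht using fun i => exists_weightSeq_le_two_mul (ω := ω) hρ (a i)
  have hT1 : 1 ≤ ∑ i ∈ s, t i := by
    obtain ⟨i, hi⟩ := hs
    exact (ht1 i).trans (Finset.single_le_sum (f := t) (fun j _ => by linarith [ht1 j]) hi)
  have hsum := h ι s t hs (fun i _ => by linarith [ht1 i])
  have hexp : Real.exp (∑ i ∈ s, -(ω (t i) / ρ)) ≤
      Real.exp (1 / ρ) ^ s.card * Real.exp (-(ω (∑ i ∈ s, t i) / (C * ρ))) := by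
    rw [← Real.exp_nat_mul, ← Real.exp_add]
    apply Real.exp_le_exp.2
    rw [Finset.sum_add_distrib] at hsum
    simp only [Finset.sum_const, nsmul_eq_mul, mul_one] at hsum
    rw [Finset.sum_neg_distrib, ← Finset.sum_div, ← sub_nonneg]
    have : s.card * (1 / ρ) + -(ω (∑ i ∈ s, t i) / (C * ρ)) - -((∑ i ∈ s, ω (t i)) / ρ) =
        (C * (∑ i ∈ s, ω (t i) + s.card) - ω (∑ i ∈ s, t i)) / (C * ρ) := by
      field_simp; ring
    rw [this]
    exact div_nonneg (by linarith) (by positivity)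
  calc ∏ i ∈ s, (weightSeq ω ρ (a i) / (a i).factorial)
      ≤ ∏ i ∈ s, (2 * (t i ^ a i / (a i).factorial) * Real.exp (-(ω (t i) / ρ))) := by
        refine Finset.prod_le_prod (fun i _ => (div_pos (weightSeq_pos _ _ _) (by positivity)).le)
          fun i _ => ?_
        calc _ ≤ 2 * (t i ^ a i * Real.exp (-(ω (t i) / ρ))) / (a i).factorial := by
              gcongr; exact ht i
          _ = _ := by ring
    _ = 2 ^ s.card * (∏ i ∈ s, (t i ^ a i / (a i).factorial)) *
          Real.exp (∑ i ∈ s, -(ω (t i) / ρ)) := by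
        rw [Finset.prod_mul_distrib, Finset.prod_mul_distrib, Finset.prod_const, Real.exp_sum]
    _ ≤ 2 ^ s.card * ((∑ i ∈ s, t i) ^ (∑ i ∈ s, a i) / (∑ i ∈ s, a i).factorial) *
          (Real.exp (1 / ρ) ^ s.card * Real.exp (-(ω (∑ i ∈ s, t i) / (C * ρ)))) := by
        gcongr
        exact prod_pow_div_factorial_le s (fun i _ => by linarith [ht1 i]) a
    _ = (2 * Real.exp (1 / ρ)) ^ s.card * ((∑ i ∈ s, t i) ^ (∑ i ∈ s, a i) *
          Real.exp (-(ω (∑ i ∈ s, t i) / (C * ρ))) / (∑ i ∈ s, a i).factorial) := by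
        rw [mul_pow]; ring
    _ ≤ _ := by
        gcongr
        exact hω.pow_mul_exp_le_weightSeq (by positivity) hT1 _

end IsPreWeightFunction

theorem le_seqCirc (M : ℕ → ℝ) {k : ℕ} (c : Composition (k + 1)) :
    M c.length * ∏ i, M (c.blocksFun i) ≤ seqCirc M (k + 1) :=
  le_ciSup (f := fun c : Composition (k + 1) => M c.length * ∏ i, M (c.blocksFun i))
    (Set.finite_range _).bddAbove c

/-- Lowering every block by one gives the orders `c.length` and `c.blocksFun i - 1`, which add up to
`k + 1` exactly. This shift doubles the parameter, hence the 2 in `H * 2`. -/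
theorem IsWeightFunction.uniformFdB {ω : ℝ → ℝ} (hω : IsWeightFunction ω)
    (h : WeightSubhomogeneous ω) : UniformFdB ω := by
  obtain ⟨H, hH, hprod⟩ := hω.exists_prod_weightSeq_le h
  refine ⟨H * 2, by linarith, fun ρ hρ => ?_⟩
  obtain ⟨A, hA, hprod⟩ := hprod (2 * ρ) (by positivity)
  obtain ⟨B, hB, hsucc⟩ := hω.exists_weightSeq_succ_le hρ
  have hHρ : 0 < H * 2 * ρ := by positivity
  refine ⟨A, by positivity, B * A, by positivity, fun k => ?_⟩
  rcases k with _ | k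
  · simp only [seqCirc, pow_zero, mul_one, assocSeq_eq_weightSeq_div, Nat.factorial_zero,
      Nat.cast_one, div_one]
    exact one_le_mul_of_one_le_of_one_le hA (hω.one_le_weightSeq hHρ 0)
  refine ciSup_le fun c => ?_
  simp only [assocSeq_eq_weightSeq_div]
  have hb : ∀ i, 1 ≤ c.blocksFun i := c.one_le_blocksFun
  have hlen : c.length ≤ k + 1 := c.length_le
  -- The index `none` carries the outer order `c.length`; it also keeps the family nonempty.
  have h1 := hprod (Option (Fin c.length)) Finset.univ
    (fun o => o.elim c.length fun i => c.blocksFun i - 1) ⟨none, Finset.mem_univ _⟩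
  have hs : ∑ i, (c.blocksFun i - 1) + c.length = k + 1 := by
    calc _ = ∑ i, (c.blocksFun i - 1) + ∑ i : Fin c.length, 1 := by simp
      _ = ∑ i, (c.blocksFun i - 1 + 1) := Finset.sum_add_distrib.symm
      _ = ∑ i, c.blocksFun i := Finset.sum_congr rfl fun i _ => Nat.sub_add_cancel (hb i)
      _ = k + 1 := c.sum_blocksFun
  simp only [Fintype.prod_option, Fintype.sum_option, Option.elim, Finset.card_univ,
    Fintype.card_option, Fintype.card_fin] at h1
  rw [add_comm c.length (∑ i, (c.blocksFun i - 1)), hs, ← mul_assoc H] at h1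
  calc weightSeq ω ρ c.length / c.length.factorial *
        ∏ i, (weightSeq ω ρ (c.blocksFun i) / (c.blocksFun i).factorial)
      ≤ weightSeq ω (2 * ρ) c.length / c.length.factorial *
        ∏ i, (B * (weightSeq ω (2 * ρ) (c.blocksFun i - 1) / (c.blocksFun i - 1).factorial)) := by
        gcongr
        · exact Finset.prod_nonneg fun i _ => (div_pos (weightSeq_pos ..) (by positivity)).le
        · exact (div_pos (weightSeq_pos ..) (by positivity)).le
        · exact hω.weightSeq_mono hρ (by linarith) _
        · exact fun i _ => (div_pos (weightSeq_pos ..) (by positivity)).le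
        · rename_i i _
          rw [← mul_div_assoc]
          have := hsucc (c.blocksFun i - 1)
          rw [Nat.sub_add_cancel (hb i)] at this
          have := weightSeq_pos ω (2 * ρ) (c.blocksFun i - 1)
          gcongr
          exact Nat.sub_le _ _
    _ = B ^ c.length * (weightSeq ω (2 * ρ) c.length / c.length.factorial *
        ∏ i, (weightSeq ω (2 * ρ) (c.blocksFun i - 1) / (c.blocksFun i - 1).factorial)) := by
        rw [Finset.prod_mul_distrib, Finset.prod_const, Finset.card_univ, Fintype.card_fin]; ring
    _ ≤ B ^ c.length * (A ^ (c.length + 1) *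
        (weightSeq ω (H * 2 * ρ) (k + 1) / (k + 1).factorial)) := by gcongr
    _ ≤ B ^ (k + 1) * (A ^ (k + 1 + 1) *
        (weightSeq ω (H * 2 * ρ) (k + 1) / (k + 1).factorial)) := by
        have := weightSeq_pos ω (H * 2 * ρ) (k + 1)
        gcongr
    _ = _ := by rw [mul_pow, pow_succ A (k + 1)]; ring

/-! ### The sub-additive envelope -/

noncomputable section

/-- The envelope `t ↦ sup_{l ≥ 1} ω(l t) / l`. -/
def weightEnvelope (ω : ℝ → ℝ) (t : ℝ) : ℝ := ⨆ l : Ici (1 : ℝ), ω (l * t) / l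

end

/-- By normalization, `ω(e^s)` depends only on `max s 0`, a convex function of `s`, through a
function that is convex and increasing on `[0, ∞)`. -/
theorem IsWeightFunction.convexOn_exp_univ {ω : ℝ → ℝ} (hω : IsWeightFunction ω) :
    ConvexOn ℝ univ fun s => ω (Real.exp s) := by
  have hmax : ∀ s, ω (Real.exp s) = ω (Real.exp (max s 0)) := by
    intro s
    rcases le_total s 0 with h | h
    · rw [max_eq_right h, hω.zero_on_unit _ ⟨(Real.exp_pos _).le, Real.exp_le_one_iff.2 h⟩,
        hω.zero_on_unit _ (by simp)]
    · rw [max_eq_left h]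
  refine ⟨convex_univ, fun x _ y _ a b ha hb hab => ?_⟩
  have h := hω.convexOn_exp.2 (mem_Ici.2 (le_max_right x 0)) (mem_Ici.2 (le_max_right y 0))
    ha hb hab
  simp only [smul_eq_mul] at h ⊢
  rw [hmax (a * x + b * y), hmax x, hmax y]
  refine le_trans (hω.monotoneOn (mem_Ici.2 (Real.exp_pos _).le) (mem_Ici.2 (Real.exp_pos _).le)
    (Real.exp_le_exp.2 ?_)) h
  refine max_le ?_ (by positivity)
  gcongr <;> exact le_max_left _ _

/-- For `t > 0`, `σ(t) / t` is the supremum of `ω(u) / u` over `u ≥ t`, hence decreasing in `t`, and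
this forces sub-additivity. Convexity of `σ(e^s)` survives because it is a supremum of scaled
translates of `ω(e^s)`; it gives continuity away from 0. -/
theorem IsWeightFunction.equivSubadditiveWeight {ω : ℝ → ℝ} (hω : IsWeightFunction ω)
    (h : WeightSubhomogeneous ω) : EquivSubadditiveWeight ω := by
  obtain ⟨C, hC, h⟩ := hω.exists_mul_le_of_weightSubhomogeneous h
  set σ := weightEnvelope ω with hσ
  have l0 : ∀ l : Ici (1 : ℝ), 0 < (l : ℝ) := fun l => by linarith [mem_Ici.1 l.2]
  have hle : ∀ t, 0 ≤ t → ∀ l : Ici (1 : ℝ), ω (l * t) / l ≤ C * (ω t + 1) := fun t ht l => by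
    rw [div_le_iff₀ (l0 l)]
    linarith [h l l.2 t ht]
  have hbdd : ∀ t, 0 ≤ t → BddAbove (range fun l : Ici (1 : ℝ) => ω (l * t) / l) := fun t ht =>
    ⟨_, by rintro _ ⟨l, rfl⟩; exact hle t ht l⟩
  have le_σ : ∀ t, 0 ≤ t → ∀ l : Ici (1 : ℝ), ω (l * t) / l ≤ σ t := fun t ht l =>
    le_ciSup (hbdd t ht) l
  have ω_le : ∀ t, 0 ≤ t → ω t ≤ σ t := fun t ht => by
    simpa using le_σ t ht ⟨1, by simp⟩
  have σ_le : ∀ t, 0 ≤ t → σ t ≤ C * (ω t + 1) := fun t ht => ciSup_le (hle t ht)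
  have nonneg : ∀ t, 0 ≤ t → 0 ≤ σ t := fun t ht => (hω.nonneg t ht).trans (ω_le t ht)
  have mono : MonotoneOn σ (Ici 0) := by
    intro s hs t ht hst
    refine ciSup_mono (hbdd t ht) fun l => ?_
    have := l0 l
    have hs : 0 ≤ s := hs
    have ht : 0 ≤ t := ht
    gcongr
    exact hω.monotoneOn (mem_Ici.2 (by positivity)) (mem_Ici.2 (by positivity)) (by gcongr)
  have sub : WeightSubadditive σ := by
    -- The left side is the term of the supremum defining `σ s` at the multiplier `l * ((s + t) /
    -- s)`.
    have part : ∀ s t : ℝ, 0 ≤ s → 0 ≤ t → 0 < s + t → ∀ l : Ici (1 : ℝ),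
        s / (s + t) * (ω (l * (s + t)) / l) ≤ σ s := by
      intro s t hs ht hst l
      have := l0 l
      rcases hs.eq_or_lt with rfl | hs
      · simpa using nonneg 0 le_rfl
      have h1 : 1 ≤ (l : ℝ) * ((s + t) / s) :=
        one_le_mul_of_one_le_of_one_le l.2 ((one_le_div hs).2 (by linarith))
      have h2 := le_σ s hs.le ⟨_, h1⟩
      have h3 : (l : ℝ) * ((s + t) / s) * s = l * (s + t) := by field_simp
      simp only [h3] at h2
      refine le_trans (le_of_eq ?_) h2
      field_simp
    intro s t hs ht
    rcases (add_nonneg hs ht).eq_or_lt with h0 | hst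
    · have h1 : s = 0 := by linarith
      have h2 : t = 0 := by linarith
      subst h1 h2
      simpa using nonneg 0 le_rfl
    refine ciSup_le fun l => ?_
    have h1 := part s t hs ht hst l
    have h2 := part t s ht hs (by linarith) l
    rw [add_comm t s] at h2
    have h3 : s / (s + t) + t / (s + t) = 1 := by field_simp
    calc ω (l * (s + t)) / l
        = (s / (s + t) + t / (s + t)) * (ω (l * (s + t)) / l) := by rw [h3, one_mul]
      _ ≤ _ := by rw [add_mul]; exact add_le_add h1 h2
  have conv : ConvexOn ℝ univ fun s => σ (Real.exp s) := by
    refine ⟨convex_univ, fun x _ y _ a b ha hb hab => ciSup_le fun l => ?_⟩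
    have hl := l0 l
    have h1 := hω.convexOn_exp_univ.2 (mem_univ (x + Real.log l)) (mem_univ (y + Real.log l))
      ha hb hab
    have h2 : a • (x + Real.log l) + b • (y + Real.log l) = a * x + b * y + Real.log l := by
      simp only [smul_eq_mul]
      linear_combination Real.log l * hab
    have h3 : ∀ z, Real.exp (z + Real.log l) = l * Real.exp z := fun z => by
      rw [Real.exp_add, Real.exp_log hl, mul_comm]
    rw [h2] at h1
    simp only [h3, smul_eq_mul] at h1 ⊢
    have h4 := le_σ (Real.exp x) (Real.exp_pos _).le l
    have h5 := le_σ (Real.exp y) (Real.exp_pos _).le l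
    calc _ ≤ (a * ω (l * Real.exp x) + b * ω (l * Real.exp y)) / l := by gcongr
      _ = a * (ω (l * Real.exp x) / l) + b * (ω (l * Real.exp y) / l) := by ring
      _ ≤ _ := by gcongr
  -- Comparison with the point 1, where `ω` vanishes, gives a linear bound, and hence continuity of
  -- `σ` at 0.
  have lin : ∀ t, 0 ≤ t → σ t ≤ C * t := by
    intro t ht
    refine ciSup_le fun l => ?_
    have hl := l0 l
    rw [div_le_iff₀ hl]
    rcases le_total (l * t) 1 with h1 | h1
    · rw [hω.zero_on_unit _ ⟨by positivity, h1⟩]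
      positivity
    · have := h _ h1 1 zero_le_one
      rw [hω.zero_on_unit 1 (by simp)] at this
      simp only [mul_one, zero_add] at this
      linarith
  have σ_zero : σ 0 = 0 := le_antisymm (by simpa using lin 0 le_rfl) (nonneg 0 le_rfl)
  have cont : ContinuousOn σ (Ici 0) := by
    intro t ht
    rcases (mem_Ici.1 ht).eq_or_lt with rfl | ht
    · have hlin : Tendsto (fun t : ℝ => C * t) (nhdsWithin 0 (Ici 0)) (nhds 0) := by
        have : Continuous fun t : ℝ => C * t := by fun_prop
        simpa using (this.tendsto 0).mono_left nhdsWithin_le_nhds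
      rw [ContinuousWithinAt, σ_zero]
      exact tendsto_of_tendsto_of_tendsto_of_le_of_le' tendsto_const_nhds hlin
        (eventually_nhdsWithin_of_forall nonneg) (eventually_nhdsWithin_of_forall lin)
    · have h1 : Continuous fun s => σ (Real.exp s) := by
        rw [← continuousOn_univ]
        exact conv.continuousOn isOpen_univ
      have h2 : ContinuousAt (fun t => σ (Real.exp (Real.log t))) t :=
        h1.continuousAt.comp (Real.continuousAt_log ht.ne')
      refine (h2.congr ?_).continuousWithinAt
      filter_upwards [lt_mem_nhds ht] with u hu
      rw [Real.exp_log hu]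
  have hO : ω =O[atTop] σ := by
    refine IsBigO.of_bound 1 ?_
    filter_upwards [eventually_ge_atTop 0] with t ht
    rw [Real.norm_of_nonneg (hω.nonneg t ht), Real.norm_of_nonneg (nonneg t ht), one_mul]
    exact ω_le t ht
  have hO' : σ =O[atTop] ω := by
    refine IsBigO.of_bound (2 * C) ?_
    filter_upwards [eventually_ge_atTop 0, hω.tendsto_atTop.eventually_ge_atTop 1] with t ht ht1
    rw [Real.norm_of_nonneg (hω.nonneg t ht), Real.norm_of_nonneg (nonneg t ht)]
    nlinarith [σ_le t ht]
  refine ⟨σ, ?_, sub, hO', hO⟩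
  refine ⟨nonneg, cont, mono, ?_, ?_, hω.log_isLittleO.trans_isBigO hO,
    conv.subset (subset_univ _) (convex_Ici 0)⟩
  · refine tendsto_atTop_mono' _ ?_ hω.tendsto_atTop
    filter_upwards [eventually_ge_atTop 0] with t ht using ω_le t ht
  · refine IsBigO.of_bound 2 ?_
    filter_upwards [eventually_ge_atTop 0] with t ht
    rw [Real.norm_of_nonneg (nonneg _ (by positivity)), Real.norm_of_nonneg (nonneg t ht), two_mul,
      two_mul]
    exact sub t t ht ht

/-! ### Faà di Bruno's formula and stability under composition -/

theorem iteratedDeriv_sum_mul_pow_zero (s : Finset ℕ) (a : ℕ → ℝ) (m : ℕ) :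
    iteratedDeriv m (fun x : ℝ => ∑ j ∈ s, a j / j.factorial * x ^ j) 0 =
      if m ∈ s then a m else 0 := by
  rw [iteratedDeriv_fun_sum fun i _ => by fun_prop]
  simp only [iteratedDeriv_const_mul_field, iteratedDeriv_fun_pow_zero]
  rw [← Finset.sum_ite_eq s m a]
  refine Finset.sum_congr rfl fun j _ => ?_
  split_ifs with h
  · field_simp
  · simp

/-- The Faà di Bruno sum over ordered partitions, regrouped according to the sizes of the parts. -/
theorem sum_orderedFinpartition_eq_sum_composition (a b : ℕ → ℝ) (n : ℕ) :
    ∑ c : OrderedFinpartition n, a c.length * ∏ i, b (c.partSize i) =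
      n.factorial * ∑ c : Composition n, a c.length / c.length.factorial *
        ∏ i, (b (c.blocksFun i) / (c.blocksFun i).factorial) := by
  -- In place of a count of partitions, two polynomials are given the prescribed derivatives at 0,
  -- and the `n`-th derivative of `P ∘ Q` is computed twice: by Faà di Bruno and by composing power
  -- series. `Q` starts at degree 1 so that `Q 0 = 0`.
  set P : ℝ → ℝ := fun y => ∑ j ∈ Finset.range (n + 1), a j / j.factorial * y ^ j with hP
  set Q : ℝ → ℝ := fun x => ∑ j ∈ Finset.Icc 1 n, b j / j.factorial * x ^ j with hQ
  have hP' : ∀ m ≤ n, iteratedDeriv m P 0 = a m := fun m hm => by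
    rw [hP, iteratedDeriv_sum_mul_pow_zero, if_pos (Finset.mem_range.2 (by omega))]
  have hQ' : ∀ m, 1 ≤ m → m ≤ n → iteratedDeriv m Q 0 = b m := fun m h1 hm => by
    rw [hQ, iteratedDeriv_sum_mul_pow_zero, if_pos (Finset.mem_Icc.2 ⟨h1, hm⟩)]
  have hQ0 : Q 0 = 0 := by
    refine Finset.sum_eq_zero fun j hj => ?_
    rw [zero_pow (by have := (Finset.mem_Icc.1 hj).1; omega), mul_zero]
  have hPa : AnalyticAt ℝ P (Q 0) := by fun_prop
  have hQa : AnalyticAt ℝ Q 0 := by fun_prop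
  have h1 : iteratedDeriv n (P ∘ Q) 0 =
      ∑ c : OrderedFinpartition n, a c.length * ∏ i, b (c.partSize i) := by
    rw [iteratedDeriv_comp_eq_sum_orderedFinpartition (n := n) hPa.contDiffAt hQa.contDiffAt le_rfl]
    refine Finset.sum_congr rfl fun c _ => ?_
    rw [hQ0, hP' _ c.length_le]
    congr 1
    exact Finset.prod_congr rfl fun i _ => hQ' _ (c.partSize_pos i) (c.partSize_le i)
  obtain ⟨r, hr⟩ := hPa.hasFPowerSeriesAt.comp hQa.hasFPowerSeriesAt
  have h2 := hr.factorial_smul 1 n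
  rw [← iteratedDeriv_eq_iteratedFDeriv, h1] at h2
  rw [← h2, nsmul_eq_mul, FormalMultilinearSeries.comp, sum_apply]
  congr 1
  refine Finset.sum_congr rfl fun c _ => ?_
  rw [FormalMultilinearSeries.compAlongComposition_apply]
  simp only [FormalMultilinearSeries.applyComposition, FormalMultilinearSeries.ofScalars,
    smul_apply, ContinuousMultilinearMap.mkPiAlgebraFin_apply,
    List.prod_ofFn, Function.comp_apply, Finset.prod_const_one, smul_eq_mul, mul_one]
  rw [hQ0, hP' _ c.length_le]
  congr 1
  refine Finset.prod_congr rfl fun i _ => ?_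
  rw [hQ' _ (c.one_le_blocksFun i) (c.blocksFun_le i)]

theorem norm_iteratedFDeriv_comp_le_sum {E F G : Type*} [NormedAddCommGroup E] [NormedSpace ℝ E]
    [NormedAddCommGroup F] [NormedSpace ℝ F] [NormedAddCommGroup G] [NormedSpace ℝ G]
    {f : F → G} {g : E → F} {x : E} (k : ℕ) (hf : ContDiffAt ℝ k f (g x))
    (hg : ContDiffAt ℝ k g x) :
    ‖iteratedFDeriv ℝ k (f ∘ g) x‖ ≤ k.factorial * ∑ c : Composition k,
      ‖iteratedFDeriv ℝ c.length f (g x)‖ / c.length.factorial *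
        ∏ i, (‖iteratedFDeriv ℝ (c.blocksFun i) g x‖ / (c.blocksFun i).factorial) := by
  rw [← sum_orderedFinpartition_eq_sum_composition
    (fun j => ‖iteratedFDeriv ℝ j f (g x)‖) (fun j => ‖iteratedFDeriv ℝ j g x‖),
    iteratedFDeriv_comp hf hg le_rfl]
  exact (norm_sum_le _ _).trans
    (Finset.sum_le_sum fun c _ => c.norm_compAlongOrderedFinpartition_le _ _)

theorem le_seqCirc_of_composition (M : ℕ → ℝ) (h0 : M 0 ≤ 1) {k : ℕ} (c : Composition k) :
    M c.length * ∏ i, M (c.blocksFun i) ≤ seqCirc M k := by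
  rcases k with _ | k
  · have : c = Composition.ones 0 :=
      Fintype.card_le_one_iff.1 (by simp [composition_card]) _ _
    subst this
    simpa [seqCirc] using h0
  · exact le_seqCirc M c

theorem memBeurling_iff {E F : Type*} [NormedAddCommGroup E] [NormedSpace ℝ E]
    [NormedAddCommGroup F] [NormedSpace ℝ F] {ω : ℝ → ℝ} {U : Set E} {f : E → F} :
    MemBeurling ω U f ↔ ContDiffOn ℝ (⊤ : ℕ∞) f U ∧ ∀ K ⊆ U, IsCompact K → ∀ ρ > 0,
      ∃ C, 1 ≤ C ∧ ∀ x ∈ K, ∀ k : ℕ, ‖iteratedFDeriv ℝ k f x‖ ≤ C * weightSeq ω ρ k := by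
  have key : ∀ (a ρ C : ℝ) (k : ℕ), a * Real.exp (-(1 / ρ * youngConj ω (ρ * k))) ≤ C ↔
      a ≤ C * weightSeq ω ρ k := fun a ρ C k => by
    rw [Real.exp_neg, ← div_eq_mul_inv, div_le_iff₀ (Real.exp_pos _), weightSeq]
  simp only [MemBeurling, key]
  refine and_congr_right fun _ => forall₂_congr fun K _ => forall₃_congr fun _ ρ _ => ⟨?_, ?_⟩
  · rintro ⟨C, h⟩
    refine ⟨max C 1, le_max_right _ _, fun x hx k => (h x hx k).trans ?_⟩
    have := weightSeq_pos ω ρ k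
    gcongr
    exact le_max_left _ _
  · rintro ⟨C, _, h⟩
    exact ⟨C, h⟩

/-- Under the Faà di Bruno condition, Beurling classes are stable under composition. -/
theorem MemBeurling.comp {E F G : Type*} [NormedAddCommGroup E] [NormedSpace ℝ E]
    [NormedAddCommGroup F] [NormedSpace ℝ F] [NormedAddCommGroup G] [NormedSpace ℝ G]
    {ω : ℝ → ℝ} (hω : IsWeightFunction ω) (h : BeurlingFdB ω) {U : Set E} {V : Set F}
    (hU : IsOpen U) (hV : IsOpen V) {f : F → G} {g : E → F} (hf : MemBeurling ω V f)
    (hg : MemBeurling ω U g) (hUV : MapsTo g U V) : MemBeurling ω U (f ∘ g) := by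
  rw [memBeurling_iff] at *
  refine ⟨hf.1.comp hg.1 hUV, fun K hK hKc ρ hρ => ?_⟩
  obtain ⟨τ, hτ, C₀, hC₀, A, hA, hcirc⟩ := h ρ hρ
  -- In `2 * A`, `A` absorbs the geometric factor of `≼` and 2 the number of compositions of `k`, at
  -- most `2 ^ k`. The constant `B` from `g` then appears once per block, as `B ^ c.length`, so the
  -- parameter `ρ₂` for `f` must be chosen after it.
  obtain ⟨ρ₁, hρ₁, C₁, hC₁, habs₁⟩ := hω.exists_pow_mul_weightSeq_le (2 * A) hτ
  obtain ⟨Cg, hCg, hgK⟩ := hg.2 K hK hKc ρ₁ hρ₁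
  set B := Cg * C₁ with hB
  obtain ⟨ρ₂, hρ₂, C₂, hC₂, habs₂⟩ := hω.exists_pow_mul_weightSeq_le B hτ
  obtain ⟨Cf, hCf, hfK⟩ := hf.2 (g '' K) (hUV.mono_left hK).image_subset
    (hKc.image_of_continuousOn (hg.1.continuousOn.mono hK)) ρ₂ hρ₂
  have h1 : 1 ≤ Cf * C₂ * C₀ + 1 := by
    have : 0 ≤ Cf * C₂ * C₀ := by positivity
    linarith
  refine ⟨_, h1, fun x hx k => ?_⟩
  have hgb : ∀ a, (2 * A) ^ a * ‖iteratedFDeriv ℝ a g x‖ ≤ B * weightSeq ω τ a := fun a =>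
    calc _ ≤ (2 * A) ^ a * (Cg * weightSeq ω ρ₁ a) := by gcongr; exact hgK x hx a
      _ = Cg * ((2 * A) ^ a * weightSeq ω ρ₁ a) := by ring
      _ ≤ Cg * (C₁ * weightSeq ω τ a) := by gcongr _ * ?_; exact habs₁ a
      _ = _ := by ring
  have hfb : ∀ j, B ^ j * ‖iteratedFDeriv ℝ j f (g x)‖ ≤ Cf * C₂ * weightSeq ω τ j := fun j =>
    calc _ ≤ B ^ j * (Cf * weightSeq ω ρ₂ j) := by
          gcongr; exact hfK _ (mem_image_of_mem g hx) j
      _ = Cf * (B ^ j * weightSeq ω ρ₂ j) := by ring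
      _ ≤ Cf * (C₂ * weightSeq ω τ j) := by gcongr _ * ?_; exact habs₂ j
      _ = _ := by ring
  have hterm : ∀ c : Composition k, ‖iteratedFDeriv ℝ c.length f (g x)‖ / c.length.factorial *
      ∏ i, (‖iteratedFDeriv ℝ (c.blocksFun i) g x‖ / (c.blocksFun i).factorial) ≤
      Cf * C₂ * C₀ * (A ^ k * assocSeq ω ρ k) / (2 * A) ^ k := by
    intro c
    rw [le_div_iff₀' (by positivity)]
    have hpow : (2 * A) ^ k = ∏ i, (2 * A) ^ c.blocksFun i := by
      rw [Finset.prod_pow_eq_pow_sum, c.sum_blocksFun]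
    calc _ = ‖iteratedFDeriv ℝ c.length f (g x)‖ / c.length.factorial *
          ∏ i, ((2 * A) ^ c.blocksFun i * ‖iteratedFDeriv ℝ (c.blocksFun i) g x‖ /
            (c.blocksFun i).factorial) := by
          simp only [mul_div_assoc, Finset.prod_mul_distrib, ← hpow]; ring
      _ ≤ ‖iteratedFDeriv ℝ c.length f (g x)‖ / c.length.factorial *
          ∏ i, (B * weightSeq ω τ (c.blocksFun i) / (c.blocksFun i).factorial) := by
          gcongr _ * ?_
          refine Finset.prod_le_prod (fun i _ => by positivity) fun i _ => ?_
          gcongr ?_ / _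
          exact hgb _
      _ = B ^ c.length * ‖iteratedFDeriv ℝ c.length f (g x)‖ / c.length.factorial *
          ∏ i, assocSeq ω τ (c.blocksFun i) := by
          simp only [mul_div_assoc, Finset.prod_mul_distrib, assocSeq_eq_weightSeq_div,
            Finset.prod_const, Finset.card_univ, Fintype.card_fin]
          ring
      _ ≤ Cf * C₂ * weightSeq ω τ c.length / c.length.factorial *
          ∏ i, assocSeq ω τ (c.blocksFun i) := by
          have := Finset.prod_nonneg (s := Finset.univ)
            fun i _ => (assocSeq_pos ω τ (c.blocksFun i)).le
          gcongr ?_ / _ * _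
          exact hfb _
      _ = Cf * C₂ * (assocSeq ω τ c.length * ∏ i, assocSeq ω τ (c.blocksFun i)) := by
          rw [assocSeq_eq_weightSeq_div ω τ c.length]; ring
      _ ≤ Cf * C₂ * (C₀ * A ^ k * assocSeq ω ρ k) := by
          gcongr _ * ?_
          refine (le_seqCirc_of_composition _ ?_ c).trans (hcirc k)
          simp [assocSeq_eq_weightSeq_div, hω.weightSeq_zero hτ]
      _ = _ := by ring
  have hcard : (Fintype.card (Composition k) : ℝ) ≤ 2 ^ k := by
    rw [composition_card]
    exact_mod_cast Nat.pow_le_pow_right two_pos (Nat.sub_le k 1)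
  have hW := assocSeq_pos ω ρ k
  calc ‖iteratedFDeriv ℝ k (f ∘ g) x‖ ≤ _ := norm_iteratedFDeriv_comp_le_sum k
        ((hf.1.contDiffAt (hV.mem_nhds (hUV (hK hx)))).of_le (mod_cast le_top))
        ((hg.1.contDiffAt (hU.mem_nhds (hK hx))).of_le (mod_cast le_top))
    _ ≤ k.factorial * ∑ c : Composition k,
          (Cf * C₂ * C₀ * (A ^ k * assocSeq ω ρ k) / (2 * A) ^ k) := by
        gcongr
        exact hterm _
    _ = k.factorial * (Fintype.card (Composition k) *
          (Cf * C₂ * C₀ * (A ^ k * assocSeq ω ρ k) / (2 * A) ^ k)) := by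
        rw [Finset.sum_const, Finset.card_univ, nsmul_eq_mul]
    _ ≤ k.factorial * (2 ^ k * (Cf * C₂ * C₀ * (A ^ k * assocSeq ω ρ k) / (2 * A) ^ k)) := by
        gcongr
    _ = Cf * C₂ * C₀ * weightSeq ω ρ k := by
        rw [assocSeq_eq_weightSeq_div, mul_pow]; field_simp
    _ ≤ _ := by
        have := weightSeq_pos ω ρ k
        gcongr
        linarith

theorem BeurlingFdB.beurlingStableComp {ω : ℝ → ℝ} (hω : IsWeightFunction ω)
    (h : BeurlingFdB ω) : BeurlingStableComp ω :=
  fun _ _ _ _ _ _ _ _ _ hU hV _ _ _ hgU _ hg hf => hf.comp hω h hU hV hg hgU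

/-! ### Holomorphic functions in the Beurling class -/

/-- The supremum is tested at `t = k / μ`, the maximizer of `t ^ k * exp (-μ t)` with `μ = a / ρ`,
and `k! ≤ k ^ k` is used. If `k / μ ≤ 1`, the quantity to bound is at most 1. -/
theorem IsWeightFunction.factorial_div_pow_le_weightSeq {ω : ℝ → ℝ} (hω : IsWeightFunction ω)
    {a b ρ r : ℝ} (ha : 0 < a) (hb : 0 ≤ b) (hρ : 0 < ρ) (hr : Real.exp 1 * (a / ρ) ≤ r)
    (h : ∀ t, 1 ≤ t → ω t ≤ a * t + b) (k : ℕ) :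
    k.factorial / r ^ k ≤ Real.exp (b / ρ) * weightSeq ω ρ k := by
  set μ := a / ρ with hμ
  have hμ0 : 0 < μ := by positivity
  clear_value μ
  have h1 : (k.factorial : ℝ) / r ^ k ≤ (k / μ) ^ k * Real.exp (-k) := by
    calc (k.factorial : ℝ) / r ^ k ≤ (k : ℝ) ^ k / (Real.exp 1 * μ) ^ k := by
          gcongr; exact_mod_cast Nat.factorial_le_pow k
      _ = _ := by
          rw [mul_pow, ← Real.exp_nat_mul, mul_one, Real.exp_neg, div_pow]; field_simp
  refine h1.trans ?_
  rcases le_total 1 (k / μ) with hx | hx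
  · have h2 := hω.pow_mul_exp_le_weightSeq hρ hx k
    have h3 : -(k : ℝ) ≤ b / ρ + -(ω (k / μ) / ρ) := by
      have h4 : ω (k / μ) / ρ ≤ (a * (k / μ) + b) / ρ := by gcongr; exact h _ hx
      have h5 : (a * (k / μ) + b) / ρ = k + b / ρ := by rw [hμ]; field_simp
      linarith
    calc (k / μ) ^ k * Real.exp (-k) ≤ (k / μ) ^ k * Real.exp (b / ρ + -(ω (k / μ) / ρ)) := by
          gcongr
      _ = Real.exp (b / ρ) * ((k / μ) ^ k * Real.exp (-(ω (k / μ) / ρ))) := by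
          rw [Real.exp_add]; ring
      _ ≤ _ := by gcongr
  · refine le_trans ?_ (one_le_mul_of_one_le_of_one_le (Real.one_le_exp (x := b / ρ)
      (by positivity)) (hω.one_le_weightSeq hρ k))
    exact mul_le_one₀ (pow_le_one₀ (by positivity) hx) (Real.exp_pos _).le
      (Real.exp_le_one_iff.2 (by simp))

theorem iteratedDeriv_comp_ofReal {O : Set ℂ} (hO : IsOpen O) {f : ℂ → ℂ}
    (hf : DifferentiableOn ℂ f O) (k : ℕ) {x : ℝ} (hx : (x : ℂ) ∈ O) :
    iteratedDeriv k (fun y : ℝ => f y) x = iteratedDeriv k f x := by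
  induction k generalizing x with
  | zero => simp
  | succ k ih =>
    rw [iteratedDeriv_succ, iteratedDeriv_succ]
    have hev : iteratedDeriv k (fun y : ℝ => f y) =ᶠ[nhds x] fun y : ℝ => iteratedDeriv k f y := by
      filter_upwards [(hO.preimage Complex.continuous_ofReal).mem_nhds hx] with y hy using ih hy
    rw [hev.deriv_eq]
    have han : AnalyticAt ℂ (iteratedDeriv k f) x := by
      rw [iteratedDeriv_eq_iterate]
      exact (hf.analyticOnNhd hO).iterated_deriv k x hx
    exact han.differentiableAt.hasDerivAt.comp_ofReal.deriv

theorem exists_norm_iteratedDeriv_le {O : Set ℂ} {f : ℂ → ℂ}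
    (hf : DifferentiableOn ℂ f O) {K : Set ℂ} (hK : IsCompact K) {r : ℝ} (hr : 0 < r)
    (hKO : Metric.cthickening r K ⊆ O) :
    ∃ C, 1 ≤ C ∧ ∀ x ∈ K, ∀ k : ℕ, ‖iteratedDeriv k f x‖ ≤ C * (k.factorial / r ^ k) := by
  obtain ⟨C, hC⟩ := (hK.cthickening (r := r)).exists_bound_of_continuousOn
    (hf.continuousOn.mono hKO)
  refine ⟨max C 1, le_max_right _ _, fun x hx k => ?_⟩
  have hball : Metric.closedBall x r ⊆ Metric.cthickening r K :=
    Metric.closedBall_subset_cthickening hx r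
  have := Complex.norm_iteratedDeriv_le_of_forall_mem_sphere_norm_le k hr
    ((hf.mono (hball.trans hKO)).diffContOnCl_ball subset_rfl)
    (fun z hz => (hC z (hball (Metric.sphere_subset_closedBall hz))).trans (le_max_left C 1))
  refine this.trans (le_of_eq ?_)
  ring

/-- Cauchy estimates on discs of radius `r` suffice once `e a / ρ ≤ r`. The hypothesis covers two
regimes: `r` limited by the domain and the slope `a` arbitrarily small, or `a` fixed and `r`
arbitrarily large for entire functions. -/
theorem IsWeightFunction.memBeurling_ofReal {ω : ℝ → ℝ} (hω : IsWeightFunction ω) {O : Set ℂ}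
    (hO : IsOpen O) {f : ℂ → ℂ} (hf : DifferentiableOn ℂ f O)
    (h : ∀ K ⊆ O, IsCompact K → ∀ ρ > 0, ∃ a > 0, ∃ b ≥ 0, ∃ r > 0, Metric.cthickening r K ⊆ O ∧
      Real.exp 1 * (a / ρ) ≤ r ∧ ∀ t, 1 ≤ t → ω t ≤ a * t + b) :
    MemBeurling ω {x : ℝ | (x : ℂ) ∈ O} (fun x : ℝ => f x) := by
  refine memBeurling_iff.2 ⟨?_, fun K hK hKc ρ hρ => ?_⟩
  · exact ((hf.contDiffOn hO).restrict_scalars ℝ).comp Complex.ofRealCLM.contDiff.contDiffOn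
      fun x hx => hx
  have hKc' := hKc.image Complex.continuous_ofReal
  obtain ⟨a, ha, b, hb, r, hr, hKr, har, hab⟩ := h _ (image_subset_iff.2 hK) hKc' ρ hρ
  obtain ⟨C, hC, hCK⟩ := exists_norm_iteratedDeriv_le hf hKc' hr hKr
  refine ⟨C * Real.exp (b / ρ), one_le_mul_of_one_le_of_one_le hC
    (Real.one_le_exp (by positivity)), fun x hx k => ?_⟩
  rw [norm_iteratedFDeriv_eq_norm_iteratedDeriv, iteratedDeriv_comp_ofReal hO hf k (hK hx)]
  calc _ ≤ C * (k.factorial / r ^ k) := hCK _ (mem_image_of_mem _ hx) k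
    _ ≤ C * (Real.exp (b / ρ) * weightSeq ω ρ k) := by
      gcongr
      exact hω.factorial_div_pow_le_weightSeq ha hb hρ har hab k
    _ = _ := by ring

theorem IsPreWeightFunction.exists_le_mul_add {ω : ℝ → ℝ} (hω : IsPreWeightFunction ω) {a : ℝ}
    (ha : 0 ≤ a) (h : IsBigOWith a atTop ω fun t => t) :
    ∃ b, 0 ≤ b ∧ ∀ t, 1 ≤ t → ω t ≤ a * t + b := by
  obtain ⟨T, hT⟩ := eventually_atTop.1 h.bound
  refine ⟨ω (max T 0), hω.nonneg _ (le_max_right _ _), fun t ht => ?_⟩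
  rcases le_total T t with h1 | h1
  · have := hT t h1
    rw [Real.norm_eq_abs, Real.norm_eq_abs, abs_of_nonneg (by linarith : (0 : ℝ) ≤ t)] at this
    linarith [le_abs_self (ω t), hω.nonneg _ (le_max_right T 0)]
  · have : ω t ≤ ω (max T 0) := hω.monotoneOn (mem_Ici.2 (by linarith))
      (mem_Ici.2 (le_max_right _ _)) (h1.trans (le_max_left _ _))
    have : 0 ≤ a * t := by positivity
    linarith

theorem IsWeightFunction.memBeurling_ofReal_of_isLittleO {ω : ℝ → ℝ} (hω : IsWeightFunction ω)
    (h : WeightLittleO ω) {O : Set ℂ} (hO : IsOpen O) {f : ℂ → ℂ} (hf : DifferentiableOn ℂ f O) :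
    MemBeurling ω {x : ℝ | (x : ℂ) ∈ O} (fun x : ℝ => f x) := by
  refine hω.memBeurling_ofReal hO hf fun K hK hKc ρ hρ => ?_
  obtain ⟨r, hr, hKr⟩ := hKc.exists_cthickening_subset_open hO hK
  have ha : 0 < r * ρ / Real.exp 1 := by positivity
  obtain ⟨b, hb, hab⟩ := hω.exists_le_mul_add ha.le (h.forall_isBigOWith ha)
  exact ⟨_, ha, b, hb, r, hr, hKr, by field_simp; rfl, hab⟩

theorem IsWeightFunction.memBeurling_ofReal_of_isBigO {ω : ℝ → ℝ} (hω : IsWeightFunction ω)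
    (h : WeightBigO ω) {f : ℂ → ℂ} (hf : Differentiable ℂ f) :
    MemBeurling ω univ (fun x : ℝ => f x) := by
  have := hω.memBeurling_ofReal isOpen_univ hf.differentiableOn fun K hK hKc ρ hρ => ?_
  · simpa using this
  obtain ⟨a, ha, h⟩ := h.exists_pos
  obtain ⟨b, hb, hab⟩ := hω.exists_le_mul_add ha.le h
  exact ⟨a, ha, b, hb, _, by positivity, subset_univ _, le_rfl, hab⟩

theorem BeurlingFdB.beurlingHolClosed {ω : ℝ → ℝ} (hω : IsWeightFunction ω)
    (ho : WeightLittleO ω) (h : BeurlingFdB ω) : BeurlingHolClosed ω :=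
  fun _ _ _ hU _ hg _ _ hO hgO hf =>
    (hω.memBeurling_ofReal_of_isLittleO ho hO hf).comp hω h hU
      (hO.preimage Complex.continuous_ofReal) hg hgO

/-! ### Near-optimal even orders -/

/-- An almost supporting line of `s ↦ ω(e^s)` at `log N` has some slope `m`, and `2 * l` is an even
integer in `[m - 2, m]`. The rounding loses at most `N ^ 2`, the approximate support at most a
factor `e`. -/
theorem IsWeightFunction.exists_even_le_pow {ω : ℝ → ℝ} (hω : IsWeightFunction ω) {N : ℝ}
    (hN : 1 ≤ N) :
    ∃ l : ℕ, Real.exp (ω N - 2 * Real.log N - 1) * weightSeq ω 1 (2 * l) ≤ N ^ (2 * l) := by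
  have hs : 0 ≤ Real.log N := Real.log_nonneg hN
  have hN0 : 0 < N := by linarith
  have hcont : Continuous fun s => ω (Real.exp s) := by
    rw [← continuousOn_univ]
    exact hω.convexOn_exp_univ.continuousOn isOpen_univ
  obtain ⟨m, c, hle, hlt⟩ := hω.convexOn_exp_univ.exists_affine_le_of_lt_real
    (x := Real.log N) (a := ω (Real.exp (Real.log N)) - 1) (mem_univ _) (by simp) isClosed_univ
    (hcont.lowerSemicontinuous.lowerSemicontinuousOn _)
  rw [Real.exp_log hN0] at hlt
  have hle' : ∀ z : ℝ, m * z + c ≤ ω (Real.exp z) := fun z => hle z (mem_univ z)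
  have hneg : ∀ z ≤ 0, ω (Real.exp z) = 0 := fun z hz =>
    hω.zero_on_unit _ ⟨(Real.exp_pos _).le, Real.exp_le_one_iff.2 hz⟩
  -- A negative slope would make the affine minorant positive far to the left, where `ω(e^z) = 0`.
  have hm : 0 ≤ m := by
    by_contra! hm
    have hc : c ≤ 0 := by simpa [hω.zero_on_unit 1 (by simp)] using hle' 0
    have h1 := hle' ((1 - c) / m)
    rw [hneg _ (div_nonpos_of_nonneg_of_nonpos (by linarith) hm.le), mul_div_cancel₀ _ hm.ne] at h1
    linarith
  set l := ⌊m / 2⌋₊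
  have hl1 : 2 * (l : ℝ) ≤ m := by linarith [Nat.floor_le (by positivity : 0 ≤ m / 2)]
  have hl2 : m - 2 ≤ 2 * (l : ℝ) := by linarith [Nat.lt_floor_add_one (m / 2)]
  refine ⟨l, ?_⟩
  have hconj : youngConj ω (1 * (2 * l : ℕ)) ≤ -c := by
    refine youngConj_le fun z hz => ?_
    push_cast
    nlinarith [hle' z]
  have hpow : N ^ (2 * l) = Real.exp ((2 * l : ℕ) * Real.log N) := by
    rw [Real.exp_nat_mul, Real.exp_log hN0]
  rw [weightSeq, ← Real.exp_add, hpow]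
  apply Real.exp_le_exp.2
  push_cast at hconj ⊢
  nlinarith

/-! ### Nonnegative combinations of cosines -/

noncomputable section

/-- The pointwise closed semiring of functions generated by the functions `x ↦ c cos(s x)` with
`c ≥ 0`. -/
def cosSemiring : Subsemiring (ℝ → ℝ) :=
  (Subsemiring.closure {u | ∃ c, 0 ≤ c ∧ ∃ s : ℝ, u = fun x => c * Real.cos (s * x)})
    |>.topologicalClosure

end

theorem const_mul_cos_mem_cosSemiring {c : ℝ} (hc : 0 ≤ c) (s : ℝ) :
    (fun x => c * Real.cos (s * x)) ∈ cosSemiring :=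
  Subsemiring.le_topologicalClosure _ (Subsemiring.subset_closure ⟨c, hc, s, rfl⟩)

theorem const_mem_cosSemiring {c : ℝ} (hc : 0 ≤ c) : (fun _ => c) ∈ cosSemiring := by
  simpa using const_mul_cos_mem_cosSemiring hc 0

theorem isClosed_cosSemiring : IsClosed (cosSemiring : Set (ℝ → ℝ)) :=
  Subsemiring.isClosed_topologicalClosure _

theorem const_mul_mem_cosSemiring {c : ℝ} (hc : 0 ≤ c) {u : ℝ → ℝ} (hu : u ∈ cosSemiring) :
    (fun x => c * u x) ∈ cosSemiring :=
  mul_mem (const_mem_cosSemiring hc) hu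

theorem tsum_mem_cosSemiring {ι : Type*} {u : ι → ℝ → ℝ} (hu : ∀ i, u i ∈ cosSemiring)
    (hs : ∀ x, Summable fun i => u i x) : (fun x => ∑' i, u i x) ∈ cosSemiring := by
  refine isClosed_cosSemiring.mem_of_tendsto (f := fun s : Finset ι => ∑ i ∈ s, u i) (b := atTop)
    ?_ (Eventually.of_forall fun s => sum_mem fun i _ => hu i)
  rw [tendsto_pi_nhds]
  intro x
  simpa [HasSum] using (hs x).hasSum

theorem apply_zero_nonneg_of_mem_cosSemiring {u : ℝ → ℝ} (hu : u ∈ cosSemiring) : 0 ≤ u 0 := by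
  have hcl : IsClosed {u : ℝ → ℝ | 0 ≤ u 0} := isClosed_le continuous_const (continuous_apply 0)
  refine closure_minimal ?_ hcl hu
  intro v hv
  induction hv using Subsemiring.closure_induction with
  | mem v hv => obtain ⟨c, hc, s, rfl⟩ := hv; simpa using hc
  | zero => simp
  | one => simp
  | add v w _ _ h1 h2 => exact add_nonneg (mem_ofPred.1 h1) (mem_ofPred.1 h2)
  | mul v w _ _ h1 h2 => exact mul_nonneg (mem_ofPred.1 h1) (mem_ofPred.1 h2)

/-- The product-to-sum formula shows that the generated semiring is already the additive monoid of
the generators, and on `cos(s x)` the operation is multiplication by `2 (1 - cos(s h)) ≥ 0`. The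
closure follows by continuity. -/
theorem secondDifference_mem_cosSemiring {u : ℝ → ℝ} (hu : u ∈ cosSemiring) (h : ℝ) :
    (fun x => 2 * u x - u (x + h) - u (x - h)) ∈ cosSemiring := by
  set gens : Set (ℝ → ℝ) := {u | ∃ c, 0 ≤ c ∧ ∃ s : ℝ, u = fun x => c * Real.cos (s * x)}
  have hadd : ∀ v ∈ Subsemiring.closure gens, v ∈ AddSubmonoid.closure gens := by
    intro v hv
    induction hv using Subsemiring.closure_induction with
    | mem v hv => exact AddSubmonoid.subset_closure hv
    | zero => exact zero_mem _
    | one => exact AddSubmonoid.subset_closure ⟨1, zero_le_one, 0, by ext; simp⟩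
    | add v w _ _ h1 h2 => exact add_mem h1 h2
    | mul v w hv hw h1 h2 =>
      clear hv hw
      induction h1, h2 using AddSubmonoid.closure_induction₂ with
      | mem v w hv hw =>
        obtain ⟨c, hc, s, rfl⟩ := hv
        obtain ⟨d, hd, t, rfl⟩ := hw
        have : ((fun x => c * Real.cos (s * x)) * fun x => d * Real.cos (t * x)) =
            (fun x => c * d / 2 * Real.cos ((s + t) * x)) +
              fun x => c * d / 2 * Real.cos ((s - t) * x) := by
          ext x
          simp only [Pi.mul_apply, Pi.add_apply, add_mul, sub_mul, Real.cos_add, Real.cos_sub]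
          ring
        rw [this]
        exact add_mem (AddSubmonoid.subset_closure ⟨_, by positivity, _, rfl⟩)
          (AddSubmonoid.subset_closure ⟨_, by positivity, _, rfl⟩)
      | zero_left => simp
      | zero_right => simp
      | add_left x y z _ _ _ h1 h2 => rw [add_mul]; exact add_mem h1 h2
      | add_right x y z _ _ _ h1 h2 => rw [mul_add]; exact add_mem h1 h2
  have hcont : Continuous fun u : ℝ → ℝ => fun x => 2 * u x - u (x + h) - u (x - h) := by fun_prop
  refine map_mem_closure hcont hu (t := (cosSemiring : Set (ℝ → ℝ))) (fun v hv => ?_)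
    |> fun h => isClosed_cosSemiring.closure_subset h
  replace hv := hadd v hv
  induction hv using AddSubmonoid.closure_induction with
  | mem v hv =>
    obtain ⟨c, hc, s, rfl⟩ := hv
    have : (fun x => 2 * (c * Real.cos (s * x)) - c * Real.cos (s * (x + h)) -
        c * Real.cos (s * (x - h))) = fun x => c * (2 * (1 - Real.cos (s * h))) *
          Real.cos (s * x) := by
      ext x
      simp only [mul_add, mul_sub, Real.cos_add, Real.cos_sub]
      ring
    simp only [this]
    exact const_mul_cos_mem_cosSemiring
      (mul_nonneg hc (by linarith [Real.cos_le_one (s * h)])) s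
  | zero => simpa using const_mem_cosSemiring le_rfl
  | add v w _ _ h1 h2 =>
    refine (congrArg (· ∈ cosSemiring) ?_).mp (add_mem h1 h2)
    ext x
    simp only [Pi.add_apply]
    ring

theorem tendsto_secondDifference {v : ℝ → ℝ} (hv : ContDiff ℝ 2 v) (x : ℝ) :
    Tendsto (fun h => (h ^ 2)⁻¹ * (2 * v x - v (x + h) - v (x - h))) (nhdsWithin 0 {0}ᶜ)
      (nhds (-iteratedDeriv 2 v x)) := by
  have ho := taylor_isLittleO_univ (x₀ := x) (n := 2) (by exact_mod_cast hv)
  set R : ℝ → ℝ := fun y => v y - taylorWithinEval v 2 univ x y with hR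
  have hplus : (fun h => R (x + h)) =o[nhds 0] fun h : ℝ => h ^ 2 := by
    have ht : Tendsto (fun h : ℝ => x + h) (nhds 0) (nhds x) := by
      have : Continuous fun h : ℝ => x + h := by fun_prop
      simpa using this.tendsto 0
    simpa [Function.comp_def] using ho.comp_tendsto ht
  have hminus : (fun h => R (x - h)) =o[nhds 0] fun h : ℝ => h ^ 2 := by
    have ht : Tendsto (fun h : ℝ => x - h) (nhds 0) (nhds x) := by
      have : Continuous fun h : ℝ => x - h := by fun_prop
      simpa using this.tendsto 0
    simpa [Function.comp_def] using ho.comp_tendsto ht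
  have hlim := ((hplus.add hminus).tendsto_div_nhds_zero).mono_left
    (nhdsWithin_le_nhds (s := {0}ᶜ))
  have hlim2 := (hlim.neg).add (tendsto_const_nhds (x := -iteratedDeriv 2 v x))
  rw [neg_zero, zero_add] at hlim2
  refine hlim2.congr' ?_
  filter_upwards [self_mem_nhdsWithin] with h hh
  have hh : h ≠ 0 := hh
  simp only [hR, taylorWithinEval_succ, taylor_within_zero_eval, iteratedDerivWithin_univ]
  simp
  field_simp
  ring

/-- A pointwise limit of normalized second differences; no termwise differentiation of a
representation is needed. -/
theorem neg_iteratedDeriv_two_mem_cosSemiring {v : ℝ → ℝ} (hv : v ∈ cosSemiring)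
    (hs : ContDiff ℝ 2 v) : (fun x => -iteratedDeriv 2 v x) ∈ cosSemiring := by
  refine isClosed_cosSemiring.mem_of_tendsto (b := nhdsWithin (0 : ℝ) {0}ᶜ)
    (tendsto_pi_nhds.2 fun x => tendsto_secondDifference hs x)
    (Eventually.of_forall fun h => ?_)
  exact const_mul_mem_cosSemiring (by positivity) (secondDifference_mem_cosSemiring hv h)

theorem iteratedDeriv_two_iteratedDeriv (v : ℝ → ℝ) (n : ℕ) :
    iteratedDeriv 2 (iteratedDeriv n v) = iteratedDeriv (n + 2) v := by
  rw [iteratedDeriv_succ, iteratedDeriv_one, ← iteratedDeriv_succ, ← iteratedDeriv_succ]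

theorem iteratedDeriv_even_mem_cosSemiring {v : ℝ → ℝ} (hv : v ∈ cosSemiring)
    (hs : ContDiff ℝ (⊤ : ℕ∞) v) (l : ℕ) :
    (fun x => (-1) ^ l * iteratedDeriv (2 * l) v x) ∈ cosSemiring := by
  induction l with
  | zero => simpa using hv
  | succ l ih =>
    have hd : ContDiff ℝ (⊤ : ℕ∞) (iteratedDeriv (2 * l) v) := by
      refine contDiff_infty.2 fun n => ?_
      rw [iteratedDeriv_eq_iterate]
      exact ContDiff.iterate_deriv' n (2 * l) (contDiff_infty.1 hs _)
    have h1 := neg_iteratedDeriv_two_mem_cosSemiring ih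
      (contDiff_const.mul (contDiff_infty.1 hd 2))
    refine (congrArg (· ∈ cosSemiring) ?_).mp h1
    ext x
    rw [iteratedDeriv_const_mul_field, iteratedDeriv_two_iteratedDeriv, mul_add, mul_one, pow_succ]
    ring

/-- The even derivatives of the difference, with sign `(-1) ^ l`, stay in the semiring and are
therefore nonnegative at 0. A single cosine component thus bounds the derivative of `u` from below.
-/
theorem mul_pow_le_abs_iteratedDeriv {u : ℝ → ℝ} (hu : ContDiff ℝ (⊤ : ℕ∞) u) {c N : ℝ}
    (hmem : (fun x => u x - c * Real.cos (N * x)) ∈ cosSemiring) (l : ℕ) :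
    c * N ^ (2 * l) ≤ |iteratedDeriv (2 * l) u 0| := by
  have hc : ContDiff ℝ (⊤ : ℕ∞) fun x => c * Real.cos (N * x) := by fun_prop
  have h1 := apply_zero_nonneg_of_mem_cosSemiring
    (iteratedDeriv_even_mem_cosSemiring hmem (hu.sub hc) l)
  rw [iteratedDeriv_fun_sub (contDiff_infty.1 hu _).contDiffAt
    (contDiff_infty.1 hc _).contDiffAt, iteratedDeriv_const_mul_field,
    iteratedDeriv_comp_const_mul Real.contDiff_cos, Real.iteratedDeriv_even_cos] at h1
  simp only [mul_zero, Pi.mul_apply, Pi.pow_apply, Pi.neg_apply, Pi.one_apply, Real.cos_zero,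
    mul_one] at h1
  have h2 : ((-1 : ℝ) ^ l) * (-1) ^ l = 1 := by rw [← mul_pow]; simp
  have h3 : c * N ^ (2 * l) ≤ (-1) ^ l * iteratedDeriv (2 * l) u 0 := by
    linear_combination h1 - (c * N ^ (2 * l)) * h2
  refine h3.trans ((le_abs_self _).trans_eq ?_)
  rw [abs_mul, abs_pow, abs_neg, abs_one, one_pow, one_mul]

theorem add_pow_sub_pow_mem_cosSemiring {u v : ℝ → ℝ} (hu : u ∈ cosSemiring)
    (hv : v ∈ cosSemiring) (n : ℕ) : (u + v) ^ n - u ^ n ∈ cosSemiring := by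
  induction n with
  | zero => simp
  | succ n ih =>
    have : (u + v) ^ (n + 1) - u ^ (n + 1) =
        ((u + v) ^ n - u ^ n) * (u + v) + u ^ n * v := by ring
    rw [this]
    exact add_mem (mul_mem ih (add_mem hu hv)) (mul_mem (pow_mem hu n) hv)

theorem cos_pow_sub_mem_cosSemiring (t : ℝ) (n : ℕ) :
    (fun x => Real.cos (t * x) ^ n - (1 / 2) ^ n * Real.cos (n * t * x)) ∈ cosSemiring := by
  induction n with
  | zero => simpa using const_mem_cosSemiring le_rfl
  | succ n ih =>
    have hcos : (fun x => Real.cos (t * x)) ∈ cosSemiring := by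
      simpa using const_mul_cos_mem_cosSemiring zero_le_one t
    -- The product `cos(n t x) cos(t x)` splits into the frequencies `(n + 1) t` and `(n - 1) t`
    -- with weight 1/2 each; the second is put back as a remainder.
    have h1 := add_mem (mul_mem ih hcos)
      (const_mul_cos_mem_cosSemiring (c := (1 / 2) ^ (n + 1)) (by positivity) ((n - 1) * t))
    refine (congrArg (· ∈ cosSemiring) ?_).mp h1
    ext x
    have e1 : ((n + 1 : ℕ) : ℝ) * t * x = n * t * x + t * x := by push_cast; ring
    have e2 : ((n : ℝ) - 1) * t * x = n * t * x - t * x := by ring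
    simp only [Pi.add_apply, Pi.mul_apply, e1, e2, Real.cos_add, Real.cos_sub, pow_succ]
    ring

theorem pow_sub_mem_cosSemiring {g : ℝ → ℝ} {ε t : ℝ} (hε : 0 ≤ ε)
    (hg : (fun x => g x - ε * Real.cos (t * x)) ∈ cosSemiring) (n : ℕ) :
    (fun x => g x ^ n - ε ^ n * (1 / 2) ^ n * Real.cos (n * t * x)) ∈ cosSemiring := by
  have h1 := add_pow_sub_pow_mem_cosSemiring (const_mul_cos_mem_cosSemiring hε t) hg n
  have h2 := const_mul_mem_cosSemiring (pow_nonneg hε n) (cos_pow_sub_mem_cosSemiring t n)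
  refine (congrArg (· ∈ cosSemiring) ?_).mp (add_mem h1 h2)
  ext x
  simp only [Pi.add_apply, Pi.sub_apply, Pi.pow_apply, add_sub_cancel, mul_pow]
  ring

theorem tsum_sub_mem_cosSemiring {u : ℕ → ℝ → ℝ} (hu : ∀ i, u i ∈ cosSemiring)
    (hs : ∀ x, Summable fun i => u i x) {J : ℕ} {v : ℝ → ℝ}
    (hv : (fun x => u J x - v x) ∈ cosSemiring) : (fun x => ∑' i, u i x - v x) ∈ cosSemiring := by
  have h1 : (fun x => ∑' i, if i = J then 0 else u i x) ∈ cosSemiring := by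
    refine tsum_mem_cosSemiring (u := fun i x => if i = J then 0 else u i x) (fun i => ?_)
      fun x => ?_
    · by_cases h : i = J
      · simpa [h] using const_mem_cosSemiring le_rfl
      · simpa [h] using hu i
    · refine ((hs x).update J 0).congr fun i => ?_
      simp [Function.update_apply]
  refine (congrArg (· ∈ cosSemiring) ?_).mp (add_mem hv h1)
  ext x
  simp only [Pi.add_apply]
  rw [(hs x).tsum_eq_add_tsum_ite J]
  ring

/-! ### The cosine series, the entire function and the contradiction -/

theorem norm_iteratedFDeriv_const_mul_cos_le {ε t : ℝ} (hε : 0 ≤ ε) (ht : 0 ≤ t) (k : ℕ) (x : ℝ) :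
    ‖iteratedFDeriv ℝ k (fun x => ε * Real.cos (t * x)) x‖ ≤ ε * t ^ k := by
  rw [norm_iteratedFDeriv_eq_norm_iteratedDeriv, iteratedDeriv_const_mul_field,
    iteratedDeriv_comp_const_mul Real.contDiff_cos, norm_mul, norm_mul, norm_pow,
    Real.norm_of_nonneg hε, Real.norm_of_nonneg ht]
  gcongr
  exact mul_le_of_le_one_right (by positivity) (Real.abs_iteratedDeriv_cos_le_one k _)

/-- Since `t ^ k ≤ exp (ω(t) / ρ) * weightSeq ω ρ k`, summability against `exp (ω(t_j) / ρ)` bounds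
all derivatives at once. -/
theorem IsPreWeightFunction.memBeurling_tsum_cos {ω : ℝ → ℝ} (hω : IsPreWeightFunction ω)
    {ε t : ℕ → ℝ} (hε : ∀ j, 0 ≤ ε j) (ht : ∀ j, 1 ≤ t j)
    (hs : ∀ ρ > 0, Summable fun j => ε j * Real.exp (ω (t j) / ρ)) :
    MemBeurling ω univ fun x => ∑' j, ε j * Real.cos (t j * x) := by
  have hle : ∀ ρ > 0, ∀ k j, ε j * t j ^ k ≤ ε j * Real.exp (ω (t j) / ρ) * weightSeq ω ρ k := by
    intro ρ hρ k j
    rw [mul_assoc]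
    refine mul_le_mul_of_nonneg_left ?_ (hε j)
    have := hω.pow_mul_exp_le_weightSeq hρ (ht j) k
    rwa [Real.exp_neg, ← div_eq_mul_inv, div_le_iff₀' (Real.exp_pos _)] at this
  have hε' : ∀ k j, 0 ≤ ε j * t j ^ k := fun k j =>
    mul_nonneg (hε j) (pow_nonneg (zero_le_one.trans (ht j)) k)
  have hsum : ∀ k : ℕ, Summable fun j => ε j * t j ^ k := fun k =>
    Summable.of_nonneg_of_le (hε' k) (hle 1 one_pos k) ((hs 1 one_pos).mul_right _)
  have hsmooth : ∀ j, ContDiff ℝ (⊤ : ℕ∞) fun x => ε j * Real.cos (t j * x) := fun j => by fun_prop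
  have hbound : ∀ (k j : ℕ) (x : ℝ), (k : ℕ∞) ≤ ⊤ →
      ‖iteratedFDeriv ℝ k (fun x => ε j * Real.cos (t j * x)) x‖ ≤ ε j * t j ^ k :=
    fun k j x _ => norm_iteratedFDeriv_const_mul_cos_le (hε j) (zero_le_one.trans (ht j)) k x
  refine memBeurling_iff.2 ⟨(contDiff_tsum (v := fun k j => ε j * t j ^ k) hsmooth
    (fun k _ => hsum k) hbound).contDiffOn, fun K _ _ ρ hρ =>
    ⟨max 1 (∑' j, ε j * Real.exp (ω (t j) / ρ)), le_max_left _ _, fun x _ k => ?_⟩⟩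
  rw [iteratedFDeriv_tsum_apply (v := fun k j => ε j * t j ^ k) hsmooth
    (fun k _ => hsum k) hbound le_top]
  calc _ ≤ ∑' j, ε j * t j ^ k :=
        tsum_of_norm_bounded (hsum k).hasSum fun j => hbound k j x le_top
    _ ≤ ∑' j, ε j * Real.exp (ω (t j) / ρ) * weightSeq ω ρ k :=
        (hsum k).tsum_le_tsum (hle ρ hρ k) ((hs ρ hρ).mul_right _)
    _ = (∑' j, ε j * Real.exp (ω (t j) / ρ)) * weightSeq ω ρ k := tsum_mul_right
    _ ≤ _ := by
        have := weightSeq_pos ω ρ k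
        gcongr
        exact le_max_right _ _

theorem summable_div_add_one_pow {n : ℕ → ℕ} (hn : ∀ j, 2 ≤ n j) {R : ℝ} (hR : 0 ≤ R) :
    Summable fun j : ℕ => (R / (j + 1)) ^ n j := by
  have h2 : Summable fun j : ℕ => (R / ((j : ℝ) + 1)) ^ 2 := by
    have := ((summable_nat_add_iff 1).2 (Real.summable_one_div_nat_pow.2 one_lt_two)).mul_left
      (R ^ 2)
    refine this.congr fun j => ?_
    push_cast
    rw [div_pow]
    ring
  refine Summable.of_norm_bounded_eventually_nat h2 ?_
  filter_upwards [eventually_ge_atTop ⌈R⌉₊] with j hj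
  have hRj : R ≤ j + 1 := by linarith [Nat.ceil_le.1 hj]
  rw [Real.norm_of_nonneg (by positivity)]
  exact pow_le_pow_of_le_one (by positivity) ((div_le_one (by positivity)).2 hRj) (hn j)

theorem differentiable_tsum_div_add_one_pow {n : ℕ → ℕ} (hn : ∀ j, 2 ≤ n j) :
    Differentiable ℂ fun z : ℂ => ∑' j : ℕ, (z / (j + 1)) ^ n j := by
  intro z
  have h := Complex.differentiableOn_tsum_of_summable_norm (U := Metric.ball (0 : ℂ) (‖z‖ + 1))
    (F := fun (j : ℕ) z => (z / (j + 1)) ^ n j)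
    (summable_div_add_one_pow hn (R := ‖z‖ + 1) (by positivity))
    (fun j => by fun_prop) Metric.isOpen_ball fun j w hw => ?_
  · exact h.differentiableAt (Metric.isOpen_ball.mem_nhds (by simp))
  · have h1 : ‖w‖ ≤ ‖z‖ + 1 := (mem_ball_zero_iff.1 hw).le
    have h2 : ‖(j : ℂ) + 1‖ = j + 1 := by
      rw [← Nat.cast_succ, Complex.norm_natCast, Nat.cast_succ]
    rw [norm_pow, norm_div, h2]
    gcongr

theorem IsWeightFunction.exists_seq_of_not_weightSubhomogeneous {ω : ℝ → ℝ}
    (hω : IsWeightFunction ω) (h : ¬ WeightSubhomogeneous ω) :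
    ∃ (n : ℕ → ℕ) (t : ℕ → ℝ), ∀ j : ℕ, 2 ≤ n j ∧ 1 ≤ t j ∧ (j : ℝ) + 1 ≤ ω (t j) ∧
      8 * (j + 1) * n j * ω (t j) ≤ ω (n j * t j) ∧
      2 * Real.log (n j * t j) + 1 ≤ ω (n j * t j) / 2 := by
  have hlog : ∀ᶠ N in atTop, 2 * Real.log N + 1 ≤ ω N / 2 := by
    filter_upwards [hω.log_isLittleO.bound (by norm_num : (0 : ℝ) < 1 / 8),
      hω.tendsto_atTop.eventually_ge_atTop 4] with N h1 h2
    rw [Real.norm_of_nonneg (by linarith : 0 ≤ ω N)] at h1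
    linarith [(le_abs_self _).trans h1]
  have key : ∀ j : ℕ, ∃ (n : ℕ) (t : ℝ), 2 ≤ n ∧ 1 ≤ t ∧ (j : ℝ) + 1 ≤ ω t ∧
      8 * (j + 1) * n * ω t ≤ ω (n * t) ∧ 2 * Real.log (n * t) + 1 ≤ ω (n * t) / 2 := by
    intro j
    obtain ⟨T, hT⟩ := eventually_atTop.1
      (hlog.and (hω.tendsto_atTop.eventually_ge_atTop ((j : ℝ) + 1)))
    -- The constant 24 is 8 times 3: the real `l` is replaced by the integer `⌈l⌉₊ + 1 ≤ 3 * l`,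
    -- which is also at least 2.
    have : ∃ l, 1 ≤ l ∧ ∃ t, max T 1 ≤ t ∧ 24 * ((j : ℝ) + 1) * l * ω t < ω (l * t) := by
      by_contra! hc
      exact h ⟨24 * (j + 1), by positivity, max T 1, by positivity, hc⟩
    obtain ⟨l, hl, t, ht, hlt⟩ := this
    have ht1 : 1 ≤ t := (le_max_right _ _).trans ht
    have htT : T ≤ t := (le_max_left _ _).trans ht
    have hωt := (hT t htT).2
    have hceil := Nat.le_ceil l
    have hceil2 := (Nat.ceil_lt_add_one (by linarith : 0 ≤ l)).le
    have hn1 : l ≤ (⌈l⌉₊ + 1 : ℕ) := by push_cast; linarith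
    have hn3 : ((⌈l⌉₊ + 1 : ℕ) : ℝ) ≤ 3 * l := by push_cast; linarith
    have hnt : t ≤ (⌈l⌉₊ + 1 : ℕ) * t := le_mul_of_one_le_left (by linarith) (hl.trans hn1)
    refine ⟨⌈l⌉₊ + 1, t, ?_, ht1, hωt, ?_, (hT _ (htT.trans hnt)).1⟩
    · have := Nat.ceil_pos.2 (by linarith : 0 < l)
      omega
    · calc 8 * ((j : ℝ) + 1) * (⌈l⌉₊ + 1 : ℕ) * ω t ≤ 8 * (j + 1) * (3 * l) * ω t := by
            have : 0 ≤ ω t := le_trans (by positivity) hωt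
            gcongr
        _ = 24 * (j + 1) * l * ω t := by ring
        _ ≤ ω (l * t) := hlt.le
        _ ≤ _ := hω.monotoneOn (mem_Ici.2 (by positivity)) (mem_Ici.2 (by positivity)) (by gcongr)
  choose n t h using key
  exact ⟨n, t, h⟩

/-- If entire functions operate on the Beurling class of `ℝ`, the weight is sub-homogeneous. -/
theorem IsWeightFunction.weightSubhomogeneous_of_entire {ω : ℝ → ℝ} (hω : IsWeightFunction ω)
    (hact : ∀ F : ℂ → ℂ, Differentiable ℂ F → ∀ g : ℝ → ℝ, MemBeurling ω univ g →
      MemBeurling ω univ fun x => (F (g x)).re) : WeightSubhomogeneous ω := by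
  by_contra hnot
  obtain ⟨n, t, h⟩ := hω.exists_seq_of_not_weightSubhomogeneous hnot
  have hn : ∀ j, 2 ≤ n j := fun j => (h j).1
  have ht : ∀ j, 1 ≤ t j := fun j => (h j).2.1
  have hωt : ∀ j : ℕ, (j : ℝ) + 1 ≤ ω (t j) := fun j => (h j).2.2.1
  -- The factor `j + 1` eventually exceeds every `1 / ρ`, as Beurling membership requires, yet `ε j
  -- ^ n j` costs only `(j + 1) n_j ω(t_j)` in the exponent.
  set ε : ℕ → ℝ := fun j => Real.exp (-((j + 1) * ω (t j))) with hεdef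
  have hε : ∀ j, 0 ≤ ε j := fun j => (Real.exp_pos _).le
  have hsum : ∀ ρ > 0, Summable fun j => ε j * Real.exp (ω (t j) / ρ) := by
    intro ρ hρ
    refine Summable.of_norm_bounded_eventually_nat (Real.summable_exp_neg_nat) ?_
    filter_upwards [eventually_ge_atTop ⌈1 / ρ⌉₊] with j hj
    have hj' : 1 / ρ ≤ j := Nat.ceil_le.1 hj
    rw [Real.norm_of_nonneg (by positivity), hεdef, ← Real.exp_add]
    refine Real.exp_le_exp.2 ?_
    have h1 : ω (t j) / ρ ≤ j * ω (t j) := by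
      rw [div_eq_inv_mul, ← one_div]
      exact mul_le_mul_of_nonneg_right hj' (le_trans (by positivity) (hωt j))
    linarith [hωt j]
  set g : ℝ → ℝ := fun x => ∑' j, ε j * Real.cos (t j * x) with hg
  have hgB : MemBeurling ω univ g := hω.memBeurling_tsum_cos hε ht hsum
  have hgs : ∀ x, Summable fun j => ε j * Real.cos (t j * x) := by
    intro x
    refine Summable.of_norm_bounded (hsum 1 one_pos) fun j => ?_
    rw [norm_mul, Real.norm_of_nonneg (hε j)]
    refine mul_le_mul_of_nonneg_left ((Real.abs_cos_le_one _).trans (Real.one_le_exp ?_)) (hε j)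
    have := hω.nonneg (t j) (zero_le_one.trans (ht j))
    positivity
  have hgJ : ∀ J, (fun x => g x - ε J * Real.cos (t J * x)) ∈ cosSemiring := fun J =>
    tsum_sub_mem_cosSemiring (u := fun j x => ε j * Real.cos (t j * x))
      (fun j => const_mul_cos_mem_cosSemiring (hε j) _) hgs (J := J)
      (by simpa using const_mem_cosSemiring le_rfl)
  have hgmem : g ∈ cosSemiring :=
    tsum_mem_cosSemiring (fun j => const_mul_cos_mem_cosSemiring (hε j) _) hgs
  have hu := hact _ (differentiable_tsum_div_add_one_pow hn) g hgB
  have hueq : (fun x => (∑' j : ℕ, ((g x : ℂ) / (j + 1)) ^ n j).re) =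
      fun x => ∑' j : ℕ, (g x / (j + 1)) ^ n j := by
    ext x
    rw [← Complex.ofReal_re (∑' j : ℕ, (g x / (j + 1)) ^ n j)]
    push_cast
    rfl
  rw [hueq] at hu
  set u : ℝ → ℝ := fun x => ∑' j : ℕ, (g x / (j + 1)) ^ n j with hudef
  have hus : ∀ x, Summable fun j : ℕ => (g x / (j + 1)) ^ n j := by
    intro x
    refine Summable.of_norm_bounded (summable_div_add_one_pow hn (abs_nonneg (g x))) fun j => ?_
    rw [norm_pow, norm_div, Real.norm_eq_abs, Real.norm_of_nonneg (by positivity)]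
  have huj : ∀ j : ℕ, (fun x => (g x / (j + 1)) ^ n j) ∈ cosSemiring := fun j => by
    have : (fun x => (1 / ((j : ℝ) + 1)) * g x) ^ n j ∈ cosSemiring :=
      pow_mem (const_mul_mem_cosSemiring (by positivity) hgmem) _
    refine (congrArg (· ∈ cosSemiring) ?_).mp this
    ext x
    simp only [Pi.pow_apply]
    ring
  set c : ℕ → ℝ := fun J => (ε J / (2 * (J + 1))) ^ n J with hc
  have hmem : ∀ J, (fun x => u x - c J * Real.cos (n J * t J * x)) ∈ cosSemiring := fun J => by
    refine tsum_sub_mem_cosSemiring huj hus (J := J) ?_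
    have := const_mul_mem_cosSemiring (c := (1 / ((J : ℝ) + 1)) ^ n J) (by positivity)
      (pow_sub_mem_cosSemiring (hε J) (hgJ J) (n J))
    refine (congrArg (· ∈ cosSemiring) ?_).mp this
    ext x
    simp only [hc, div_pow, mul_pow, one_pow]
    field_simp
  obtain ⟨husm, hub⟩ := memBeurling_iff.1 hu
  obtain ⟨C, hC, hCb⟩ := hub {0} (subset_univ _) isCompact_singleton 1 one_pos
  obtain ⟨J, hJ⟩ := exists_nat_gt C
  obtain ⟨-, -, -, hbig, hlogN⟩ := h J
  have hω1 : 1 ≤ ω (t J) := by linarith [hωt J, Nat.cast_nonneg (α := ℝ) J]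
  have hn1 : (1 : ℝ) ≤ n J := by exact_mod_cast (by have := hn J; omega : 1 ≤ n J)
  have hN : 1 ≤ n J * t J := one_le_mul_of_one_le_of_one_le hn1 (ht J)
  obtain ⟨l, hl⟩ := hω.exists_even_le_pow hN
  have hlow : c J * Real.exp (ω (n J * t J) - 2 * Real.log (n J * t J) - 1) ≤ C := by
    refine le_of_mul_le_mul_right ?_ (weightSeq_pos ω 1 (2 * l))
    calc _ = c J * (Real.exp (ω (n J * t J) - 2 * Real.log (n J * t J) - 1) *
          weightSeq ω 1 (2 * l)) := by ring
      _ ≤ c J * (n J * t J) ^ (2 * l) := by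
          gcongr
      _ ≤ |iteratedDeriv (2 * l) u 0| :=
          mul_pow_le_abs_iteratedDeriv (contDiffOn_univ.1 husm) (hmem J) l
      _ ≤ C * weightSeq ω 1 (2 * l) := by
          simpa [norm_iteratedFDeriv_eq_norm_iteratedDeriv] using hCb 0 rfl (2 * l)
  -- In the factor 3, one unit comes from `ε J` and two from `2 (J + 1) ≤ exp (2 (J + 1))`, using `ω
  -- (t J) ≥ 1`.
  have hcJ : Real.exp (-(n J * (3 * (J + 1) * ω (t J)))) ≤ c J := by
    have h1 : Real.exp (-(3 * (J + 1) * ω (t J))) ≤ ε J / (2 * (J + 1)) := by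
      rw [le_div_iff₀ (by positivity)]
      have h2 : 2 * ((J : ℝ) + 1) ≤ Real.exp (2 * (J + 1)) := by
        linarith [Real.add_one_le_exp (2 * ((J : ℝ) + 1))]
      calc _ ≤ Real.exp (-(3 * (J + 1) * ω (t J))) * Real.exp (2 * (J + 1)) := by gcongr
        _ ≤ ε J := by
          rw [← Real.exp_add]
          refine Real.exp_le_exp.2 ?_
          nlinarith [mul_nonneg (by positivity : 0 ≤ (J : ℝ) + 1) (sub_nonneg.2 hω1)]
    calc _ = Real.exp (-(3 * (J + 1) * ω (t J))) ^ n J := by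
          rw [← Real.exp_nat_mul]; congr 1; ring
      _ ≤ c J := pow_le_pow_left₀ (Real.exp_pos _).le h1 _
  -- After the logarithmic loss at least `ω(n t) / 2 ≥ 4 (J + 1) n ω(t)` remains; subtracting `3 (J
  -- + 1) n ω(t)` leaves at least `J + 1`, against `C < J`.
  have hfin : Real.exp (J + 1) ≤ C := by
    refine le_trans ?_ hlow
    calc Real.exp (J + 1) ≤ Real.exp (-(n J * (3 * (J + 1) * ω (t J)))) *
          Real.exp (ω (n J * t J) - 2 * Real.log (n J * t J) - 1) := by
          rw [← Real.exp_add]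
          refine Real.exp_le_exp.2 ?_
          have h3 : (J : ℝ) + 1 ≤ (J + 1) * (n J * ω (t J)) :=
            le_mul_of_one_le_right (by positivity) (one_le_mul_of_one_le_of_one_le hn1 hω1)
          nlinarith
      _ ≤ _ := by gcongr
  linarith [Real.add_one_le_exp ((J : ℝ) + 1)]

/-! ### Transfer between the real line and Euclidean spaces -/

section

variable {E E' F G : Type*} [NormedAddCommGroup E] [NormedSpace ℝ E]
  [NormedAddCommGroup E'] [NormedSpace ℝ E'] [NormedAddCommGroup F] [NormedSpace ℝ F]
  [NormedAddCommGroup G] [NormedSpace ℝ G] {ω : ℝ → ℝ}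

theorem MemBeurling.clm_comp (L : F →L[ℝ] G) {f : E → F} (hf : MemBeurling ω univ f) :
    MemBeurling ω univ (L ∘ f) := by
  rw [memBeurling_iff] at *
  have hs := contDiffOn_univ.1 hf.1
  refine ⟨(L.contDiff.comp hs).contDiffOn, fun K hK hKc ρ hρ => ?_⟩
  obtain ⟨C, hC, h⟩ := hf.2 K hK hKc ρ hρ
  have h1 : 1 ≤ max 1 (‖L‖ * C) := le_max_left _ _
  refine ⟨_, h1, fun x hx k => ?_⟩
  have := weightSeq_pos ω ρ k
  calc _ ≤ ‖L‖ * ‖iteratedFDeriv ℝ k f x‖ :=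
        L.norm_iteratedFDeriv_comp_left (contDiff_infty.1 hs k).contDiffAt le_rfl
    _ ≤ ‖L‖ * (C * weightSeq ω ρ k) := by gcongr; exact h x hx k
    _ = ‖L‖ * C * weightSeq ω ρ k := by ring
    _ ≤ _ := by gcongr; exact le_max_right _ _

theorem MemBeurling.comp_linearIsometryEquiv (e : E' ≃ₗᵢ[ℝ] E) {f : E → F}
    (hf : MemBeurling ω univ f) : MemBeurling ω univ (f ∘ e) := by
  refine ⟨((contDiffOn_univ.1 hf.1).comp e.contDiff).contDiffOn, fun K _ hKc ρ hρ => ?_⟩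
  obtain ⟨C, h⟩ := hf.2 (e '' K) (subset_univ _) (hKc.image e.continuous) ρ hρ
  refine ⟨C, fun x hx k => ?_⟩
  rw [e.norm_iteratedFDeriv_comp_right]
  exact h _ (mem_image_of_mem e hx) k

end

noncomputable section

/-- The linear isometry between the Euclidean line and `ℝ`. -/
def euclideanLineEquiv : EuclideanSpace ℝ (Fin 1) ≃ₗᵢ[ℝ] ℝ :=
  (OrthonormalBasis.singleton (Fin 1) ℝ).repr.symm

end

theorem BeurlingHolClosed.weightSubhomogeneous {ω : ℝ → ℝ} (hω : IsWeightFunction ω)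
    (h : BeurlingHolClosed ω) : WeightSubhomogeneous ω := by
  refine hω.weightSubhomogeneous_of_entire fun F hF g hg => ?_
  have h1 := h 1 one_pos univ isOpen_univ _ (hg.comp_linearIsometryEquiv euclideanLineEquiv) univ F
    isOpen_univ (fun _ _ => mem_univ _) hF.differentiableOn
  have h2 := (h1.clm_comp Complex.reCLM).comp_linearIsometryEquiv euclideanLineEquiv.symm
  simpa [Function.comp_def] using h2

/-- Composition stability needs the outer function in the class too; `ω(t) = O(t)` ensures this for
restrictions of entire functions. -/
theorem BeurlingStableComp.weightSubhomogeneous {ω : ℝ → ℝ} (hω : IsWeightFunction ω)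
    (hO : WeightBigO ω) (h : BeurlingStableComp ω) : WeightSubhomogeneous ω := by
  refine hω.weightSubhomogeneous_of_entire fun F hF g hg => ?_
  set e := euclideanLineEquiv
  set eL : ℝ →L[ℝ] EuclideanSpace ℝ (Fin 1) :=
    e.symm.toContinuousLinearEquiv.toContinuousLinearMap
  set eR : EuclideanSpace ℝ (Fin 1) →L[ℝ] ℝ :=
    e.toContinuousLinearEquiv.toContinuousLinearMap
  have hf : MemBeurling ω univ fun x : ℝ => (F x).re :=
    (hω.memBeurling_ofReal_of_isBigO hO hF).clm_comp Complex.reCLM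
  have h1 := h 1 1 1 one_pos one_pos one_pos univ univ univ isOpen_univ isOpen_univ isOpen_univ
    _ _ (mapsTo_univ _ _) (mapsTo_univ _ _) ((hg.clm_comp eL).comp_linearIsometryEquiv e)
    ((hf.clm_comp eL).comp_linearIsometryEquiv e)
  have h2 := (h1.clm_comp eR).comp_linearIsometryEquiv e.symm
  simpa [Function.comp_def, eL, eR] using h2
-- Assembly of the implications
theorem theorem6p5 (ω : ℝ → ℝ) (hω : IsWeightFunction ω) :
    (WeightBigO ω →
      [BeurlingStableComp ω, BeurlingFdB ω, UniformFdB ω, EquivSubadditiveWeight ω,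
        WeightSubhomogeneous ω].TFAE) ∧
    (WeightLittleO ω →
      [BeurlingStableComp ω, BeurlingHolClosed ω, BeurlingFdB ω, UniformFdB ω,
        EquivSubadditiveWeight ω, WeightSubhomogeneous ω].TFAE) ∧
    ((BeurlingHolClosed ω → WeightSubhomogeneous ω) ∧
      (WeightSubhomogeneous ω ↔ EquivSubadditiveWeight ω) ∧
      (EquivSubadditiveWeight ω → UniformFdB ω) ∧
      (UniformFdB ω → BeurlingFdB ω) ∧
      (BeurlingFdB ω → BeurlingStableComp ω)) := by
  have h65 : WeightSubhomogeneous ω ↔ EquivSubadditiveWeight ω :=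
    ⟨hω.equivSubadditiveWeight, hω.weightSubhomogeneous_of_equiv⟩
  have h54 : EquivSubadditiveWeight ω → UniformFdB ω := fun h => hω.uniformFdB (h65.2 h)
  have h31 : BeurlingFdB ω → BeurlingStableComp ω := BeurlingFdB.beurlingStableComp hω
  refine ⟨fun hO => ?_, fun ho => ?_, BeurlingHolClosed.weightSubhomogeneous hω, h65, h54,
    UniformFdB.beurlingFdB, h31⟩
  · tfae_have 1 → 5 := BeurlingStableComp.weightSubhomogeneous hω hO
    tfae_have 5 ↔ 4 := h65
    tfae_have 4 → 3 := h54
    tfae_have 3 → 2 := UniformFdB.beurlingFdB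
    tfae_have 2 → 1 := h31
    tfae_finish
  · tfae_have 1 → 6 := BeurlingStableComp.weightSubhomogeneous hω ho.isBigO
    tfae_have 2 → 6 := BeurlingHolClosed.weightSubhomogeneous hω
    tfae_have 6 ↔ 5 := h65
    tfae_have 5 → 4 := h54
    tfae_have 4 → 3 := UniformFdB.beurlingFdB
    tfae_have 3 → 1 := h31
    tfae_have 3 → 2 := BeurlingFdB.beurlingHolClosed hω ho
    tfae_finish
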